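/- Let $X=\{\sigma_1,\dots,\sigma_N\}$ be a finite simplicial, cubical or cell complex whose cells are listed so that $X_k=\{\sigma_1,\dots,\sigma_k\}$ is a subcomplex for every $0\le k\le N$; only the integral boundary matrix of $X$ in the basis $\sigma_1,\dots,\sigma_N$ and the dimensions of the cells are used. For a matrix $B$ let $L_B(j)=\max\{i\mid B_{ij}\neq 0\}$, and $L_B(j)=-\infty$ if column $j$ is zero. Column reduction over a ring treats $j=1,\dots,N$ in this order: while there is $i<j$ with $L_B(i)=L_B(j)\neq-\infty$, add $-(B_{L_B(j),j}/B_{L_B(i),i})$ times column $i$ to column $j$. Over a field $\Bbbk$, started from the boundary matrix, this is the standard algorithm for the persistence diagrams of $X_0\subset\dots\subset X_N$ with coefficients in $\Bbbk$. Let $M\ge 0$. The decision algorithm leaves out the cells of dimension greater than $M+1$ and reduces the boundary matrix over $\mathbb Z$; if, when the inner loop for a column $j$ has ended, column $j$ is nonzero and its pivot $B_{L_B(j),j}$ is not $\pm1$, it prints $p=|B_{L_B(j),j}|$, returns "dependent" and stops; if this never happens, it returns "independent". Then: (1) The decision algorithm always halts, and it returns "independent" if and only if $H_q(X_n,X_m;\mathbb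 Z)$ is free for all $0\le m<n\le N$ and all $q=0,\dots,M$. (2) If it returns "dependent" and prints $p$, then $p\ge2$, and there are $0\le m<n\le N$, $0\le q\le M$ and $r\ge 0$ with $H_q(X_n,X_m;\mathbb Z)\cong\mathbb Z/p\mathbb Z\oplus\mathbb Z^r$. (3) Its time complexity is the same as that of the algorithm for persistence diagrams, where the cost is the number of elementary operations (arithmetic operations on coefficients, comparisons, and writing of table entries each count as one). That is, there is an absolute constant $C$ such that, on every input and for every $M$, its cost is at most $C$ times the cost of the persistence algorithm over any field of characteristic $0$ on the same input; and, for every field $\Bbbk$, all $N$ and $M$, and every class of inputs with $N$ cells that contains the simplicial complexes with $N$ cells, the worst-case costs of the two algorithms over this class are finite and each is at most $C$ times the other. -/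

import Mathlib

namespace FieldChoice

/-! ### Filtered cell complexes -/

/-- A finite cell complex with cells `σ_0, …, σ_{N-1}` listed in such an order that every initial
segment `X_n = {σ_i | i < n}` is a subcomplex. The complex is given combinatorially, by the
dimensions of the cells and the integral incidence numbers: `incidence i j` is the coefficient of
`σ_i` in `∂ σ_j`. Simplicial and cubical complexes with chosen orientations of the cells, and
CW complexes with their cellular boundary operators, are of this form. -/
structure FilteredComplex (N : ℕ) where
  /-- the dimension of a cell -/
  dim : Fin N → ℕ
  /-- the matrix of the boundary operator in the basis of the cells -/
  incidence : Matrix (Fin N) (Fin N) ℤ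
  /-- the boundary of a cell consists of cells of one dimension less -/
  dim_eq : ∀ i j, incidence i j ≠ 0 → dim j = dim i + 1
  /-- every initial segment is a subcomplex: the boundary of a cell consists of earlier cells -/
  lt : ∀ i j, incidence i j ≠ 0 → i < j
  /-- `∂ ∘ ∂ = 0` -/
  sq_zero : incidence * incidence = 0

namespace FilteredComplex

variable {N : ℕ} (X : FilteredComplex N)

/-- The complex comes from a finite simplicial complex: the cells are the members `σ i` of a finite
abstract simplicial complex with vertices in `ℕ`, listed so that every face of a simplex precedes
it, and the boundary of a simplex is the usual alternating sum of its facets with respect to the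
order of the vertices. -/
def IsSimplicial : Prop :=
  ∃ σ : Fin N → Finset ℕ,
    Function.Injective σ ∧
    (∀ i, (σ i).card = X.dim i + 1) ∧
    (∀ j (s : Finset ℕ), s.Nonempty → s ⊆ σ j → ∃ i, i ≤ j ∧ σ i = s) ∧
    ∀ i j, X.incidence i j =
      ∑ v ∈ σ j, if σ i = (σ j).erase v then (-1) ^ ((σ j).filter (· < v)).card else 0

/-! ### Relative homology -/

/-- The group `C_q(X_n; ℤ)` of integral `q`-chains of `X_n`, inside the group of all chains. -/
def chains (n q : ℕ) : Submodule ℤ (Fin N → ℤ) where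
  carrier := {c | ∀ i, c i ≠ 0 → i.val < n ∧ X.dim i = q}
  zero_mem' := by simp
  add_mem' := by
    intro a b ha hb i hi
    by_cases h : a i = 0
    · exact hb i (by simpa [h] using hi)
    · exact ha i h
  smul_mem' := by
    intro r a ha i hi
    exact ha i (fun h => hi (by simp [h]))

/-- The group of all chains of `X_n`, of mixed degree. -/
def allChains (N n : ℕ) : Submodule ℤ (Fin N → ℤ) where
  carrier := {c | ∀ i, c i ≠ 0 → i.val < n}
  zero_mem' := by simp
  add_mem' := by
    intro a b ha hb i hi
    by_cases h : a i = 0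
    · exact hb i (by simpa [h] using hi)
    · exact ha i h
  smul_mem' := by
    intro r a ha i hi
    exact ha i (fun h => hi (by simp [h]))

/-- The boundary operator. -/
def boundary : (Fin N → ℤ) →ₗ[ℤ] (Fin N → ℤ) := X.incidence.mulVecLin

/-- Relative `q`-cycles of `(X_n, X_m)`: the `q`-chains of `X_n` whose boundary lies in `X_m`. -/
def relCycles (n m q : ℕ) : Submodule ℤ (Fin N → ℤ) :=
  X.chains n q ⊓ (allChains N m).comap X.boundary

/-- Relative `q`-boundaries of `(X_n, X_m)`: boundaries of `(q+1)`-chains of `X_n`, up to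
`q`-chains of `X_m`. -/
def relBoundaries (n m q : ℕ) : Submodule ℤ (Fin N → ℤ) :=
  (X.chains n (q + 1)).map X.boundary ⊔ X.chains m q

/-- The relative homology group `H_q(X_n, X_m; ℤ)` (for `m ≤ n`). -/
abbrev RelHomology (n m q : ℕ) : Type :=
  X.relCycles n m q ⧸ (X.relBoundaries n m q).submoduleOf (X.relCycles n m q)

/-- `H_q(X_n, X_m; ℤ)` is free for all `0 ≤ m < n ≤ N` and all `q = 0, …, M`. -/
def AllRelHomologyFree (M : ℕ) : Prop :=
  ∀ q ≤ M, ∀ m n : ℕ, m < n → n ≤ N → Module.Free ℤ (X.RelHomology n m q)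

end FilteredComplex

/-! ### Programs with a step count -/

/-- A program with result in `α`. The state counts the elementary operations that have been
executed; a run that does not halt has the value `none`. -/
abbrev Prog (α : Type) : Type := StateT ℕ Option α

/-- One elementary operation with result `a`: an arithmetic operation on two coefficients,
a comparison of two coefficients or of two indices, or writing one entry of a table. -/
def tick {α : Type} (a : α) : Prog α := fun t => some (a, t + 1)

/-- The result of a run, `none` if the program does not halt. -/
def Prog.output {α : Type} (p : Prog α) : Option α := (p 0).map Prod.fst

/-- The number of elementary operations of a run, `⊤` if the program does not halt. -/
def Prog.cost {α : Type} (p : Prog α) : ℕ∞ :=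
  match p 0 with
  | none => ⊤
  | some r => (r.2 : ℕ∞)

/-! ### Left-to-right column reduction -/

section Reduction

variable {N : ℕ} {R : Type} [Zero R] [Add R] [Mul R] [Neg R] [Div R] [DecidableEq R]

/-- The first row `r` in the list with `B r j ≠ 0`. -/
def firstNonzero (B : Matrix (Fin N) (Fin N) R) (j : Fin N) :
    List (Fin N) → Prog (Option (Fin N))
  | [] => pure none
  | r :: rs => do
    let nz ← tick (decide (B r j ≠ 0))
    if nz then pure (some r) else firstNonzero B j rs

/-- `L_B(j)`, the largest row index of a nonzero entry of column `j`, by scanning the column from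
the bottom; `none` stands for `-∞`. -/
def pivotRow (B : Matrix (Fin N) (Fin N) R) (j : Fin N) : Prog (Option (Fin N)) :=
  firstNonzero B j (List.finRange N).reverse

/-- The first column `i` in the list whose recorded pivot row is `l`. -/
def findColumn (low : Fin N → Option (Fin N)) (l : Fin N) :
    List (Fin N) → Prog (Option (Fin N))
  | [] => pure none
  | i :: is => do
    let eq ← tick (decide (low i = some l))
    if eq then pure (some i) else findColumn low l is

/-- Add `s` times column `i` to column `j`, in the rows of the list, entry by entry. -/
def addMultiple (s : R) (i j : Fin N) :
    List (Fin N) → Matrix (Fin N) (Fin N) R → Prog (Matrix (Fin N) (Fin N) R)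
  | [], B => pure B
  | r :: rs, B => do
    let x ← tick (s * B r i)
    let y ← tick (B r j + x)
    let B' ← tick (B.updateRow r (Function.update (B r) j y))
    addMultiple s i j rs B'

/-- The inner loop: while there is `i < j` with `L_B(i) = L_B(j) ≠ -∞`, subtract the multiple of
column `i` from column `j` that cancels the pivot of column `j`. The table `low` records `L_B(i)`
for the columns `i` that have been treated before. Returns the new matrix and `L_B(j)`.
The first argument bounds the number of evaluations of the loop condition; if the loop has not
ended by then, the run counts as not halting. -/
def reduceColumn (low : Fin N → Option (Fin N)) (j : Fin N) :
    ℕ → Matrix (Fin N) (Fin N) R → Prog (Matrix (Fin N) (Fin N) R × Option (Fin N))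
  | 0, _ => failure
  | fuel + 1, B => do
    let l? ← pivotRow B j
    match l? with
    | none => pure (B, none)
    | some l =>
      let i? ← findColumn low l ((List.finRange N).take j.val)
      match i? with
      | none => pure (B, some l)
      | some i =>
        let a ← tick (B l j / B l i)
        let s ← tick (-a)
        let B' ← addMultiple s i j (List.finRange N) B
        reduceColumn low j fuel B'

/-- The outer loop of the algorithm for persistence diagrams, over the columns of the list. -/
def pdLoop : List (Fin N) → (Fin N → Option (Fin N)) → Matrix (Fin N) (Fin N) R →
    Prog (Matrix (Fin N) (Fin N) R × (Fin N → Option (Fin N)))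
  | [], low, B => pure (B, low)
  | j :: js, low, B => do
    let (B', l?) ← reduceColumn low j (N + 1) B
    let low' ← tick (Function.update low j l?)
    pdLoop js low' B'

end Reduction

/-- The answers of the decision algorithm; "dependent" comes with the printed number. -/
inductive Verdict
  | independent
  | dependent (p : ℕ)

/-- The outer loop of the decision algorithm, over the columns of the list: cells of dimension
greater than `M + 1` are left out, and the run ends with "dependent" at the first column whose
pivot is not `±1`. -/
def testLoop {N : ℕ} (dim : Fin N → ℕ) (M : ℕ) :
    List (Fin N) → (Fin N → Option (Fin N)) → Matrix (Fin N) (Fin N) ℤ → Prog Verdict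
  | [], _, _ => pure Verdict.independent
  | j :: js, low, B => do
    let small ← tick (decide (dim j ≤ M + 1))
    if small then
      let (B', l?) ← reduceColumn low j (N + 1) B
      match l? with
      | none =>
        let low' ← tick (Function.update low j none)
        testLoop dim M js low' B'
      | some l =>
        let pos ← tick (decide (B' l j = 1))
        let neg ← tick (decide (B' l j = -1))
        if pos || neg then
          let low' ← tick (Function.update low j (some l))
          testLoop dim M js low' B'
        else
          let p ← tick (B' l j).natAbs
          pure (Verdict.dependent p)
    else
      testLoop dim M js low B

namespace FilteredComplex

variable {N : ℕ} (X : FilteredComplex N)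

/-- The algorithm for the persistence diagrams with coefficients in a field `k`: it reduces the
boundary matrix over `k`, with division in `k`. It returns the reduced matrix with the table of its
pivot rows `L(j)`, whose pairs `(L(j), j)` are the finite birth-death pairs. -/
def persistence (k : Type) [Field k] [DecidableEq k] :
    Prog (Matrix (Fin N) (Fin N) k × (Fin N → Option (Fin N))) :=
  pdLoop (List.finRange N) (fun _ => none) (X.incidence.map (Int.cast : ℤ → k))

/-- The decision algorithm for the degrees `0, …, M`: it reduces the boundary matrix over `ℤ`. -/
def independenceTest (M : ℕ) : Prog Verdict :=
  testLoop X.dim M (List.finRange N) (fun _ => none) X.incidence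

end FilteredComplex

end FieldChoice

/-! Reduction only adds multiples of earlier columns to later ones. While all pivots are ±1, the
divisions in ℤ are exact, and every reduced column is the boundary of an integral chain with
coefficient 1 at its own cell (`Reduced`). These chains form a unitriangular basis of the chains in
the degrees treated. Since distinct columns have distinct pivot rows, reduced columns together with
the cells of X_m give an echelon basis of the relative boundaries of (X_n, X_m)
(`Reduced.relBoundaries_eq_span`). If all pivots are units, this group is pure in the group of
chains, so relative homology is torsion-free and, being finitely generated, free
(`Reduced.free_relHomology`).

Now let p be the first pivot that is not a unit, in row l and column j. In the homology of (X_{j+1},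
X_l) the cell l is a cycle. Column j shows that p times its class vanishes, and the echelon basis
shows that no multiple vanishes unless p divides the factor. Dividing out this class amounts to
replacing X_l by X_{l+1}. The pivots in the remaining rows are units, so the quotient is
torsion-free, and the extension splits as ℤ/p plus a free group (`StopsAt.exists_equiv`).

For the cost, the map from ℤ to a field of characteristic 0 is injective and respects division by
±1. Hence the two runs perform the same operations on the columns of dimension at most M + 1 until
the test stops (`Agrees`, `testLoop_spec`), and the bookkeeping costs at most a factor 4. In
positive characteristic the runs may differ, so the worst cases are compared through N³. The upper
bound holds because every column operation lowers a pivot row; the lower bound comes from a path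
with many long chords (`SlowGraph`). -/

namespace FieldChoice

/-! ### Runs of programs -/

/-- The program that halts with value `a` after `c` elementary operations. -/
def Prog.done {α : Type} (a : α) (c : ℕ) : Prog α := fun t => some (a, t + c)

/-- The program `p`, run after `c` elementary operations. -/
def Prog.delay {α : Type} (c : ℕ) (p : Prog α) : Prog α := fun t => p (t + c)

namespace Prog

variable {α β : Type}

theorem done_bind (a : α) (c : ℕ) (f : α → Prog β) : (done a c >>= f) = delay c (f a) := rfl

theorem pure_eq_done (a : α) : (pure a : Prog α) = done a 0 := rfl

theorem delay_done (a : α) (c d : ℕ) : delay c (done a d) = done a (c + d) := by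
  funext t; simp [delay, done, add_assoc]

theorem delay_delay (c d : ℕ) (p : Prog α) : delay c (delay d p) = delay (c + d) p := by
  funext t; simp [delay, add_assoc]

theorem delay_map (c : ℕ) (p : Prog α) (f : α → β) :
    f <$> delay c p = delay c (f <$> p) := rfl

theorem map_done (a : α) (c : ℕ) (f : α → β) : f <$> done a c = done (f a) c := rfl

theorem output_done (a : α) (c : ℕ) : (done a c).output = some a := rfl

theorem cost_done (a : α) (c : ℕ) : (done a c).cost = c := by
  simp [done, cost]

theorem tick_bind (a : α) (f : α → Prog β) : (tick a >>= f) = delay 1 (f a) := rfl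

end Prog

open Prog

/-! ### The parts of the reduction -/

/-- `l` is the pivot row of the column `v`, with `none` for a zero column. -/
def IsPivot {N : ℕ} {R : Type} [Zero R] (v : Fin N → R) : Option (Fin N) → Prop
  | none => ∀ r, v r = 0
  | some l => v l ≠ 0 ∧ ∀ r, l < r → v r = 0

theorem IsPivot.unique {N : ℕ} {R : Type} [Zero R] {v : Fin N → R} {o o' : Option (Fin N)}
    (h : IsPivot v o) (h' : IsPivot v o') : o = o' := by
  cases o with
  | none =>
    cases o' with
    | none => rfl
    | some l => exact absurd (h l) h'.1
  | some l =>
    cases o' with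
    | none => exact absurd (h' l) h.1
    | some l' =>
      rcases lt_trichotomy l l' with hl | hl | hl
      · exact absurd (h.2 _ hl) h'.1
      · rw [hl]
      · exact absurd (h'.2 _ hl) h.1

section

variable {N : ℕ} {R R' : Type} [Zero R] [DecidableEq R] [Zero R'] [DecidableEq R']

theorem firstNonzero_congr {B : Matrix (Fin N) (Fin N) R} {B' : Matrix (Fin N) (Fin N) R'}
    {j : Fin N} (h : ∀ r, B r j = 0 ↔ B' r j = 0) (rs : List (Fin N)) :
    firstNonzero B j rs = firstNonzero B' j rs := by
  induction rs with
  | nil => rfl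
  | cons r rs ih => simp only [firstNonzero, ih, ne_eq, h]

theorem firstNonzero_eq (B : Matrix (Fin N) (Fin N) R) (j : Fin N) (rs : List (Fin N)) :
    ∃ c ≤ rs.length,
      firstNonzero B j rs = done (rs.find? fun r => decide (B r j ≠ 0)) c := by
  induction rs with
  | nil => exact ⟨0, le_rfl, rfl⟩
  | cons r rs ih =>
    obtain ⟨c, hc, h⟩ := ih
    by_cases hr : B r j = 0
    · refine ⟨1 + c, by simp; omega, ?_⟩
      simp [firstNonzero, hr, tick_bind, h, delay_done]
    · refine ⟨1, by simp, ?_⟩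
      simp [firstNonzero, hr, tick_bind, pure_eq_done, delay_done]

theorem pivotRow_congr {B : Matrix (Fin N) (Fin N) R} {B' : Matrix (Fin N) (Fin N) R'}
    {j : Fin N} (h : ∀ r, B r j = 0 ↔ B' r j = 0) : pivotRow B j = pivotRow B' j :=
  firstNonzero_congr h _

theorem pivotRow_eq (B : Matrix (Fin N) (Fin N) R) (j : Fin N) :
    ∃ o, ∃ c ≤ N, IsPivot (fun r => B r j) o ∧ pivotRow B j = done o c := by
  obtain ⟨c, hc, h⟩ := firstNonzero_eq B j (List.finRange N).reverse
  refine ⟨_, c, by simpa using hc, ?_, h⟩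
  cases ho : (List.finRange N).reverse.find? fun r => decide (B r j ≠ 0) with
  | none =>
    intro r
    have := List.find?_eq_none.1 ho r (by simp)
    simpa using this
  | some l =>
    obtain ⟨h1, as, bs, h2, h3⟩ := List.find?_eq_some_iff_append.1 ho
    refine ⟨by simpa using h1, fun r hr => ?_⟩
    -- The scan runs through decreasing rows, so everything after the first hit lies above it and
    -- cannot be `r`.
    have hs : ((List.finRange N).reverse).Pairwise (· > ·) := by
      rw [List.pairwise_reverse]
      exact List.pairwise_lt_finRange N
    have hm : r ∈ (List.finRange N).reverse := by simp
    rw [h2] at hs hm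
    rcases List.mem_append.1 hm with hm | hm
    · simpa using h3 r hm
    · exfalso
      rcases List.mem_cons.1 hm with hm | hm
      · exact absurd hm hr.ne'
      · exact absurd ((List.pairwise_cons.1 (List.pairwise_append.1 hs).2.1).1 r hm) hr.not_gt

theorem findColumn_congr {low low' : Fin N → Option (Fin N)} {l : Fin N} {is : List (Fin N)}
    (h : ∀ i ∈ is, (low i = some l ↔ low' i = some l)) :
    findColumn low l is = findColumn low' l is := by
  induction is with
  | nil => rfl
  | cons i is ih =>
    have h1 := h i (by simp)
    simp only [findColumn, ih fun i hi => h i (by simp [hi]), h1]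

theorem findColumn_eq (low : Fin N → Option (Fin N)) (l : Fin N) (is : List (Fin N)) :
    ∃ o, ∃ c ≤ is.length, findColumn low l is = done o c ∧
      (o = none → ∀ i ∈ is, low i ≠ some l) ∧ ∀ i, o = some i → i ∈ is ∧ low i = some l := by
  induction is with
  | nil => exact ⟨none, 0, le_rfl, rfl, by simp, by simp⟩
  | cons i is ih =>
    obtain ⟨o, c, hc, h, h1, h2⟩ := ih
    by_cases hi : low i = some l
    · refine ⟨some i, 1, by simp, ?_, by simp, ?_⟩
      · simp [findColumn, hi, tick_bind, pure_eq_done, delay_done]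
      · rintro _ ⟨⟩
        exact ⟨by simp, hi⟩
    · refine ⟨o, 1 + c, by simp; omega, ?_, ?_, ?_⟩
      · simp [findColumn, hi, tick_bind, h, delay_done]
      · intro ho i' hi'
        rcases List.mem_cons.1 hi' with rfl | hi'
        · exact hi
        · exact h1 ho i' hi'
      · intro i' hi'
        exact ⟨List.mem_cons_of_mem _ (h2 i' hi').1, (h2 i' hi').2⟩

theorem mem_take_finRange {i j : Fin N} : i ∈ (List.finRange N).take j.val ↔ i < j := by
  rw [List.mem_take_iff_getElem]
  constructor
  · rintro ⟨n, hn, rfl⟩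
    simp only [List.getElem_finRange, Fin.lt_def]
    simp at hn ⊢
    omega
  · intro h
    exact ⟨i.val, by simp; omega, by simp⟩

theorem findColumn_take_eq (low : Fin N → Option (Fin N)) (l j : Fin N) :
    ∃ o, ∃ c ≤ N, findColumn low l ((List.finRange N).take j.val) = done o c ∧
      (o = none → ∀ i < j, low i ≠ some l) ∧ ∀ i, o = some i → i < j ∧ low i = some l := by
  obtain ⟨o, c, hc, h, h1, h2⟩ := findColumn_eq low l ((List.finRange N).take j.val)
  refine ⟨o, c, hc.trans (by simp), h, ?_, ?_⟩
  · intro ho i hi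
    exact h1 ho i (mem_take_finRange.2 hi)
  · intro i hi
    exact ⟨mem_take_finRange.1 (h2 i hi).1, (h2 i hi).2⟩

end

section

variable {N : ℕ} {R : Type}

/-- Entrywise updating agrees with one simultaneous update because column `i` is never written and
no row is visited twice. -/
theorem addMultiple_eq [Add R] [Mul R] (s : R) {i j : Fin N} (hij : i ≠ j) (rs : List (Fin N)) (hrs : rs.Nodup)
    (B : Matrix (Fin N) (Fin N) R) :
    addMultiple s i j rs B = done
      (B.updateCol j fun r => if r ∈ rs then B r j + s * B r i else B r j) (3 * rs.length) := by
  induction rs generalizing B with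
  | nil =>
    simp only [addMultiple, pure_eq_done]
    congr 1
    ext a b
    by_cases hb : b = j <;> simp [hb]
  | cons r rs ih =>
    rw [List.nodup_cons] at hrs
    simp only [addMultiple, tick_bind, ih hrs.2, delay_done]
    congr 1
    · ext a b
      by_cases hb : b = j
      · subst hb
        by_cases ha : a = r
        · subst ha
          simp [hrs.1]
        · simp [ha, Matrix.updateRow_apply, hij]
      · by_cases ha : a = r
        · subst ha
          simp [hb]
        · simp [ha, hb, Matrix.updateRow_apply]
    · simp only [List.length_cons]; omega

theorem addMultiple_finRange [Add R] [Mul R] (s : R) {i j : Fin N} (hij : i ≠ j) (B : Matrix (Fin N) (Fin N) R) :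
    addMultiple s i j (List.finRange N) B = done
      (B.updateCol j fun r => B r j + s * B r i) (3 * N) := by
  rw [addMultiple_eq s hij _ (List.nodup_finRange N)]
  simp

variable [Zero R] [Add R] [Mul R] [Neg R] [Div R] [DecidableEq R]

/-- The loop condition of the inner loop: it fails because the column is zero, or because no
earlier column has the same pivot row, or it holds and one column operation is carried out. -/
theorem reduceColumn_succ (low : Fin N → Option (Fin N)) (j : Fin N) (fuel : ℕ)
    (B : Matrix (Fin N) (Fin N) R) :
    (∃ c ≤ 2 * N, ∃ o, IsPivot (fun r => B r j) o ∧ (∀ l, o = some l → ∀ i < j, low i ≠ some l) ∧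
      reduceColumn low j (fuel + 1) B = done (B, o) c) ∨
    ∃ c ≤ 5 * N + 2, 3 * N ≤ c ∧ ∃ l i, IsPivot (fun r => B r j) (some l) ∧ i < j ∧ low i = some l ∧
      reduceColumn low j (fuel + 1) B = delay c (reduceColumn low j fuel
        (B.updateCol j fun r => B r j + -(B l j / B l i) * B r i)) := by
  obtain ⟨o, c, hc, ho, h⟩ := pivotRow_eq B j
  cases o with
  | none =>
    refine Or.inl ⟨c, by omega, none, ho, by simp, ?_⟩
    simp only [reduceColumn, h, done_bind, pure_eq_done, delay_done, add_zero]
  | some l =>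
    obtain ⟨o', c', hc', h', h1, h2⟩ := findColumn_take_eq low l j
    cases o' with
    | none =>
      refine Or.inl ⟨c + c', by omega, some l, ho, ?_, ?_⟩
      · rintro _ ⟨⟩
        exact h1 rfl
      · simp only [reduceColumn, h, h', done_bind, pure_eq_done, delay_done, add_zero]
    | some i =>
      obtain ⟨hi, hl⟩ := h2 i rfl
      -- At most `N` operations each for the pivot scan and the table search, two for the factor,
      -- three per row for the addition.
      refine Or.inr ⟨c + (c' + (1 + 1 + 3 * N)), by omega, by omega, l, i, ho, hi, hl, ?_⟩
      simp only [reduceColumn, h, h', done_bind, tick_bind, addMultiple_finRange _ hi.ne, done_bind,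
        delay_delay]

/-- The same step for two tables and matrices that cannot be told apart by the loop condition. -/
theorem reduceColumn_succ_congr {R' : Type} [Zero R'] [Add R'] [Mul R'] [Neg R'] [Div R']
    [DecidableEq R'] (low low' : Fin N → Option (Fin N)) (j : Fin N) (fuel : ℕ)
    (B : Matrix (Fin N) (Fin N) R) (B' : Matrix (Fin N) (Fin N) R')
    (hB : ∀ r, B r j = 0 ↔ B' r j = 0)
    (hlow : ∀ l, B l j ≠ 0 → ∀ i < j, (low i = some l ↔ low' i = some l)) :
    (∃ c o, IsPivot (fun r => B r j) o ∧
      reduceColumn low j (fuel + 1) B = done (B, o) c ∧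
      reduceColumn low' j (fuel + 1) B' = done (B', o) c) ∨
    ∃ c l i, B l j ≠ 0 ∧ i < j ∧ low i = some l ∧
      reduceColumn low j (fuel + 1) B = delay c (reduceColumn low j fuel
        (B.updateCol j fun r => B r j + -(B l j / B l i) * B r i)) ∧
      reduceColumn low' j (fuel + 1) B' = delay c (reduceColumn low' j fuel
        (B'.updateCol j fun r => B' r j + -(B' l j / B' l i) * B' r i)) := by
  obtain ⟨o, c, -, ho, h⟩ := pivotRow_eq B j
  have hp := (pivotRow_congr hB).symm.trans h
  cases o with
  | none =>
    refine Or.inl ⟨c, none, ho, ?_, ?_⟩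
    · simp only [reduceColumn, h, done_bind, pure_eq_done, delay_done, add_zero]
    · simp only [reduceColumn, hp, done_bind, pure_eq_done, delay_done, add_zero]
  | some l =>
    obtain ⟨o', c', -, h', -, h2⟩ := findColumn_take_eq low l j
    have hf := (findColumn_congr (fun i hi => hlow l ho.1 i
      (mem_take_finRange.1 hi))).symm.trans h'
    cases o' with
    | none =>
      refine Or.inl ⟨c + c', some l, ho, ?_, ?_⟩
      · simp only [reduceColumn, h, h', done_bind, pure_eq_done, delay_done, add_zero]
      · simp only [reduceColumn, hp, hf, done_bind, pure_eq_done, delay_done, add_zero]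
    | some i =>
      obtain ⟨hi, hl⟩ := h2 i rfl
      refine Or.inr ⟨c + (c' + (1 + 1 + 3 * N)), l, i, ho.1, hi, hl, ?_, ?_⟩
      · simp only [reduceColumn, h, h', done_bind, tick_bind, addMultiple_finRange _ hi.ne, done_bind,
          delay_delay]
      · simp only [reduceColumn, hp, hf, done_bind, tick_bind, addMultiple_finRange _ hi.ne, done_bind,
          delay_delay]

end

/-! ### Reduction of one column -/

section

variable {N : ℕ} {R : Type} [CommRing R] [Div R] [DecidableEq R]

/-- The inner loop halts if all pivots divide exactly. It changes column `j` only, within every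
set of columns that is closed under the operations that can occur, and makes its pivot row
different from those of the earlier columns. -/
theorem reduceColumn_halts_aux (low : Fin N → Option (Fin N)) (j : Fin N)
    (B : Matrix (Fin N) (Fin N) R) (P : (Fin N → R) → Prop)
    (hdiv : ∀ i < j, ∀ l, low i = some l → ∀ a, a / B l i * B l i = a)
    (hzero : ∀ i < j, ∀ l, low i = some l → ∀ r, l < r → B r i = 0)
    (hP : ∀ w i l s, P w → w l ≠ 0 → i < j → low i = some l → P fun r => w r + s * B r i)
    (fuel : ℕ) (w : Fin N → R) (hw : P w) (hf : ∀ r : Fin N, fuel ≤ r.val → w r = 0) :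
    ∃ v o c, reduceColumn low j (fuel + 1) (B.updateCol j w) = done (B.updateCol j v, o) c ∧
      c ≤ (fuel + 1) * (5 * N + 2) ∧ P v ∧ IsPivot v o ∧
      ∀ l, o = some l → ∀ i < j, low i ≠ some l := by
  -- The support of `w` lies in the rows below `fuel`. Each operation cancels the pivot and lowers
  -- this bound by one; the extra unit of fuel pays for the evaluation at which the loop condition
  -- fails.
  induction fuel generalizing w with
  | zero =>
    rcases reduceColumn_succ low j 0 (B.updateCol j w) with
      ⟨c, hc, o, ho, hl, h⟩ | ⟨c, hc, -, l, i, ho, hi, hl, h⟩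
    · exact ⟨w, o, c, h, by omega, hw, by simpa using ho, hl⟩
    · exact absurd (hf l (Nat.zero_le _)) (by simpa using ho.1)
  | succ fuel ih =>
    rcases reduceColumn_succ low j (fuel + 1) (B.updateCol j w) with
      ⟨c, hc, o, ho, hl, h⟩ | ⟨c, hc, -, l, i, ho, hi, hl, h⟩
    · refine ⟨w, o, c, h, ?_, hw, by simpa using ho, hl⟩
      rw [add_mul]; omega
    · obtain ⟨h1, h2⟩ := ho
      simp only [Matrix.updateCol_self] at h1 h2
      simp only [Matrix.updateCol_self, Matrix.updateCol_ne hi.ne, Matrix.updateCol_idem] at h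
      obtain ⟨v, o, d, h3, h4, h5⟩ := ih (fun r => w r + -(w l / B l i) * B r i)
        (hP w i l _ hw h1 hi hl) (by
          intro r hr
          rcases lt_trichotomy l r with hlr | rfl | hlr
          · simp [h2 r hlr, hzero i hi l hl r hlr]
          · simp [hdiv i hi l hl]
          · exact absurd (hf l (by have := Fin.lt_def.1 hlr; omega)) h1)
      refine ⟨v, o, c + d, by rw [h, h3, delay_done], ?_, h5⟩
      rw [add_mul]; omega

theorem reduceColumn_halts (low : Fin N → Option (Fin N)) (j : Fin N)
    (B : Matrix (Fin N) (Fin N) R) (P : (Fin N → R) → Prop)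
    (hdiv : ∀ i < j, ∀ l, low i = some l → ∀ a, a / B l i * B l i = a)
    (hzero : ∀ i < j, ∀ l, low i = some l → ∀ r, l < r → B r i = 0)
    (hP : ∀ w i l s, P w → w l ≠ 0 → i < j → low i = some l → P fun r => w r + s * B r i)
    (hw : P fun r => B r j) :
    ∃ v o c, reduceColumn low j (N + 1) B = done (B.updateCol j v, o) c ∧
      c ≤ (N + 1) * (5 * N + 2) ∧ P v ∧ IsPivot v o ∧
      ∀ l, o = some l → ∀ i < j, low i ≠ some l := by
  have := reduceColumn_halts_aux low j B P hdiv hzero hP N (fun r => B r j) hw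
    (fun r hr => absurd r.isLt (by omega))
  rwa [show B.updateCol j (fun r => B r j) = B from Matrix.updateCol_eq_self B j] at this

end

section

variable {N : ℕ} {R k : Type} [CommRing R] [Div R] [DecidableEq R] [CommRing k] [Div k]
  [DecidableEq k]

/-- The inner loop commutes with an injective ring homomorphism that respects the divisions by
pivots. Only the columns and pivot rows in the set `D` of rows matter. -/
theorem reduceColumn_map (φ : R →+* k) (hφ : Function.Injective φ) (D : Set (Fin N))
    (low low' : Fin N → Option (Fin N)) (j : Fin N) (fuel : ℕ)
    (B : Matrix (Fin N) (Fin N) R) (B' : Matrix (Fin N) (Fin N) k)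
    (hlow : ∀ l ∈ D, ∀ i < j, (low i = some l ↔ low' i = some l))
    (hcol : ∀ l ∈ D, ∀ i < j, low i = some l → ∀ r, B' r i = φ (B r i))
    (hdiv : ∀ l ∈ D, ∀ i < j, low i = some l → ∀ a, φ (a / B l i) = φ a / φ (B l i))
    (hD : ∀ l ∈ D, ∀ i < j, low i = some l → ∀ r, B r i ≠ 0 → r ∈ D)
    (hj : ∀ r, B' r j = φ (B r j)) (hjD : ∀ r, B r j ≠ 0 → r ∈ D) :
    reduceColumn low' j fuel B' =
      (fun x => (B'.updateCol j fun r => φ (x.1 r j), x.2)) <$> reduceColumn low j fuel B := by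
  induction fuel generalizing B B' with
  | zero => rfl
  | succ fuel ih =>
    rcases reduceColumn_succ_congr low low' j fuel B B'
      (fun r => by rw [hj, map_eq_zero_iff φ hφ]) (fun l hl => hlow l (hjD l hl)) with
      ⟨c, o, -, h, h'⟩ | ⟨c, l, i, hl, hi, hli, h, h'⟩
    · rw [h, h', map_done]
      congr 2
      ext a b
      by_cases hb : b = j
      · subst hb; simp [hj]
      · simp [hb]
    · have hlD := hjD l hl
      rw [h, h', delay_map, ih (B.updateCol j fun r => B r j + -(B l j / B l i) * B r i)]
      · simp only [Matrix.updateCol_idem]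
      · intro l' hl' i' hi' hli' r
        rw [Matrix.updateCol_ne hi'.ne, Matrix.updateCol_ne hi'.ne, hcol l' hl' i' hi' hli']
      · intro l' hl' i' hi' hli' a
        rw [Matrix.updateCol_ne hi'.ne, hdiv l' hl' i' hi' hli']
      · intro l' hl' i' hi' hli' r
        rw [Matrix.updateCol_ne hi'.ne]
        exact hD l' hl' i' hi' hli' r
      · intro r
        simp only [Matrix.updateCol_self, hj, hcol l hlD i hi hli, map_add, map_mul, map_neg,
          hdiv l hlD i hi hli]
      · intro r
        rw [Matrix.updateCol_self]
        intro hr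
        -- Both columns vanish in a row outside `D`, hence so does their combination.
        by_contra hrD
        apply hr
        rw [not_not.1 (mt (hjD r) hrD), not_not.1 (mt (hD l hlD i hi hli r) hrD)]
        simp

end

theorem Prog.done_injective {α : Type} {a b : α} {c d : ℕ} (h : done a c = done b d) :
    a = b ∧ c = d := by
  have := congrFun h 0
  simpa [done] using this

theorem drop_finRange {N : ℕ} (j : Fin N) :
    (List.finRange N).drop j.val = j :: (List.finRange N).drop (j.val + 1) := by
  rw [List.drop_eq_getElem_cons (by simp)]
  simp

/-! ### The persistence algorithm over a field -/

section

variable {N : ℕ} {k : Type} [Field k]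

/-- The table `low` lists pivot rows of columns of `B`, and `B` lowers the dimension by one. -/
structure IsPivotTable (dim : Fin N → ℕ) (low : Fin N → Option (Fin N))
    (B : Matrix (Fin N) (Fin N) k) : Prop where
  isPivot : ∀ i l, low i = some l → IsPivot (fun r => B r i) (some l)
  dim_eq : ∀ r i, B r i ≠ 0 → dim i = dim r + 1

theorem FilteredComplex.isPivotTable_initial (X : FilteredComplex N) :
    IsPivotTable X.dim (fun _ => none) (X.incidence.map (Int.cast : ℤ → k)) where
  isPivot := by simp
  dim_eq := fun r i h => X.dim_eq r i (by
    rintro h0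
    simp [h0] at h)

variable [DecidableEq k]

theorem IsPivotTable.reduceColumn {dim : Fin N → ℕ} {low : Fin N → Option (Fin N)}
    {B : Matrix (Fin N) (Fin N) k} (h : IsPivotTable dim low B) (j : Fin N) :
    ∃ x c, reduceColumn low j (N + 1) B = done x c ∧ c ≤ (N + 1) * (5 * N + 2) ∧
      IsPivotTable dim (Function.update low j x.2) x.1 := by
  obtain ⟨v, o, c, h1, h2, h3, h4, -⟩ := reduceColumn_halts low j B
    -- A column that is added shares a pivot row with column `j`, so both cells have the same
    -- dimension and homogeneity persists.
    (fun w => ∀ r, w r ≠ 0 → dim j = dim r + 1)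
    (fun i _ l hl a => div_mul_cancel₀ a (h.isPivot i l hl).1)
    (fun i _ l hl => (h.isPivot i l hl).2)
    (by
      intro w i l s hw hl _ hli r hr
      by_cases hwr : w r = 0
      · have h5 := h.dim_eq r i (by rintro h0; simp [hwr, h0] at hr)
        have h6 := h.dim_eq l i (h.isPivot i l hli).1
        have h7 := hw l hl
        omega
      · exact hw r hwr)
    (fun r => h.dim_eq r j)
  refine ⟨_, c, h1, h2, ?_, ?_⟩
  · intro i l hl
    by_cases hi : i = j
    · subst hi
      simp only [Function.update_self] at hl
      subst hl
      simpa using h4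
    · simp only [Function.update_of_ne hi] at hl
      simpa [Matrix.updateCol_ne hi] using h.isPivot i l hl
  · intro r i
    by_cases hi : i = j
    · subst hi
      simpa using h3 r
    · simpa [Matrix.updateCol_ne hi] using h.dim_eq r i

theorem IsPivotTable.pdLoop {dim : Fin N → ℕ} {low : Fin N → Option (Fin N)}
    {B : Matrix (Fin N) (Fin N) k} (h : IsPivotTable dim low B) (js : List (Fin N)) :
    ∃ x c, pdLoop js low B = done x c ∧ c ≤ js.length * ((N + 1) * (5 * N + 2) + 1) := by
  induction js generalizing low B with
  | nil => exact ⟨_, 0, rfl, by simp⟩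
  | cons j js ih =>
    obtain ⟨⟨B', o⟩, c, h1, h2, h3⟩ := h.reduceColumn j
    obtain ⟨y, d, h4, h5⟩ := ih h3
    refine ⟨y, c + (1 + d), ?_, ?_⟩
    · simp only [FieldChoice.pdLoop, h1, done_bind, tick_bind]
      rw [h4, delay_done, delay_done]
    · rw [List.length_cons, add_mul, one_mul]
      omega

namespace FilteredComplex

theorem persistence_cost_le (X : FilteredComplex N) :
    (X.persistence k).cost ≤ ((15 * N ^ 3 : ℕ) : ℕ∞) := by
  obtain ⟨x, c, h, hc⟩ := (X.isPivotTable_initial (k := k)).pdLoop (List.finRange N)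
  rw [persistence, h, cost_done]
  rw [List.length_finRange] at hc
  -- The bound in `hc` expands to 5N³ + 7N² + 3N, and 5 + 7 + 3 = 15.
  have : c ≤ 15 * N ^ 3 := by
    rcases Nat.eq_zero_or_pos N with rfl | hN
    · simpa using hc
    · refine hc.trans ?_
      have h1 : N * 1 ≤ N * N := Nat.mul_le_mul_left N hN
      have h2 : N * (N * 1) ≤ N * (N * N) := Nat.mul_le_mul_left N h1
      nlinarith
  exact_mod_cast this

end FilteredComplex

end

/-! ### The decision algorithm -/

namespace FilteredComplex

variable {N : ℕ} (X : FilteredComplex N)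

theorem boundary_apply (v : Fin N → ℤ) (r : Fin N) :
    X.boundary v r = ∑ i, X.incidence r i * v i := rfl

theorem dim_eq_of_boundary_ne_zero {n q : ℕ} {v : Fin N → ℤ} (hv : v ∈ X.chains n q) {r : Fin N}
    (hr : X.boundary v r ≠ 0) : q = X.dim r + 1 := by
  rw [boundary_apply] at hr
  obtain ⟨i, -, hi⟩ := Finset.exists_ne_zero_of_sum_ne_zero hr
  rw [← (hv i (right_ne_zero_of_mul hi)).2]
  exact X.dim_eq r i (left_ne_zero_of_mul hi)

theorem chains_mono {m n : ℕ} (h : m ≤ n) (q : ℕ) : X.chains m q ≤ X.chains n q :=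
  fun _ hc i hi => ⟨(hc i hi).1.trans_le h, (hc i hi).2⟩

theorem single_mem_chains {j : Fin N} {n : ℕ} (h : j.val < n) (a : ℤ) :
    Pi.single j a ∈ X.chains n (X.dim j) := by
  intro i hi
  by_cases hij : i = j
  · subst hij; exact ⟨h, rfl⟩
  · simp [hij] at hi

theorem boundary_single (j : Fin N) :
    X.boundary (Pi.single j 1) = fun r => X.incidence r j := by
  ext r
  simp [boundary_apply, Pi.single_apply]

/-- The matrix `B` arises from the boundary matrix by reducing the columns of dimension at most
`M + 1` among the first `n` columns, with pivot rows `low`. -/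
structure Reduced (M n : ℕ) (low : Fin N → Option (Fin N)) (B : Matrix (Fin N) (Fin N) ℤ) :
    Prop where
  untouched : ∀ j : Fin N, n ≤ j.val → ∀ r, B r j = X.incidence r j
  eq_boundary : ∀ j : Fin N, j.val < n → X.dim j ≤ M + 1 →
    ∃ v ∈ X.chains (j.val + 1) (X.dim j), v j = 1 ∧ X.boundary v = fun r => B r j
  isPivot : ∀ j : Fin N, j.val < n → X.dim j ≤ M + 1 → IsPivot (fun r => B r j) (low j)
  low_eq_none : ∀ j : Fin N, n ≤ j.val ∨ M + 1 < X.dim j → low j = none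
  low_inj : ∀ i j l, low i = some l → low j = some l → i = j

/-- All pivots of the reduced columns are `±1`. -/
def UnitPivots (low : Fin N → Option (Fin N)) (B : Matrix (Fin N) (Fin N) ℤ) : Prop :=
  ∀ i l, low i = some l → IsUnit (B l i)

variable {X} {M n : ℕ} {low : Fin N → Option (Fin N)} {B : Matrix (Fin N) (Fin N) ℤ}

namespace Reduced

theorem lt_of_low (h : X.Reduced M n low B) {i l : Fin N} (hl : low i = some l) :
    i.val < n ∧ X.dim i ≤ M + 1 := by
  have := mt (h.low_eq_none i) (by simp [hl])
  omega

theorem dim_eq (h : X.Reduced M n low B) {i r : Fin N} (hi : i.val < n) (hd : X.dim i ≤ M + 1)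
    (hr : B r i ≠ 0) : X.dim i = X.dim r + 1 := by
  obtain ⟨v, hv, -, hb⟩ := h.eq_boundary i hi hd
  exact X.dim_eq_of_boundary_ne_zero hv (by rwa [hb])

theorem isPivot_of_low (h : X.Reduced M n low B) {i l : Fin N} (hl : low i = some l) :
    IsPivot (fun r => B r i) (some l) := by
  rw [← hl]
  exact h.isPivot i (h.lt_of_low hl).1 (h.lt_of_low hl).2

theorem dim_eq_of_low (h : X.Reduced M n low B) {i l : Fin N} (hl : low i = some l) :
    X.dim i = X.dim l + 1 :=
  h.dim_eq (h.lt_of_low hl).1 (h.lt_of_low hl).2 (h.isPivot_of_low hl).1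

theorem initial : X.Reduced M 0 (fun _ => none) X.incidence where
  untouched := fun _ _ _ => rfl
  eq_boundary := by simp
  isPivot := by simp
  low_eq_none := by simp
  low_inj := by simp

theorem skip {j : Fin N} (h : X.Reduced M j.val low B) (hj : M + 1 < X.dim j) :
    X.Reduced M (j.val + 1) low B := by
  have key : ∀ i : Fin N, i.val < j.val + 1 → X.dim i ≤ M + 1 → i.val < j.val := by
    intro i hi hd
    have : i ≠ j := by rintro rfl; omega
    have := Fin.val_ne_of_ne this
    omega
  exact
    { untouched := fun i hi => h.untouched i (by omega)
      eq_boundary := fun i hi hd => h.eq_boundary i (key i hi hd) hd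
      isPivot := fun i hi hd => h.isPivot i (key i hi hd) hd
      low_eq_none := fun i hi => h.low_eq_none i (by omega)
      low_inj := h.low_inj }

/-- Unit pivots make integer division exact, so the loop halts as over a field. The chain bounding
column `j` changes only by chains on earlier cells, which leaves its coefficient 1 at `j` alone. The
new pivot itself need not be a unit. -/
theorem reduceColumn {j : Fin N} (h : X.Reduced M j.val low B) (hu : UnitPivots low B)
    (hj : X.dim j ≤ M + 1) :
    ∃ v o c, reduceColumn low j (N + 1) B = done (B.updateCol j v, o) c ∧
      X.Reduced M (j.val + 1) (Function.update low j o) (B.updateCol j v) := by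
  obtain ⟨v, o, c, h1, -, ⟨u, hu1, hu2, hu3⟩, h4, h5⟩ := reduceColumn_halts low j B
    (fun w => ∃ v ∈ X.chains (j.val + 1) (X.dim j), v j = 1 ∧ X.boundary v = w)
    (fun i _ l hl a => by
      rcases Int.isUnit_iff.1 (hu i l hl) with h | h <;> simp [h])
    (fun i _ l hl => (h.isPivot_of_low hl).2)
    (by
      rintro w i l s ⟨v, hv, hv1, hb⟩ hl hi hli
      obtain ⟨v', hv', -, hb'⟩ := h.eq_boundary i (h.lt_of_low hli).1 (h.lt_of_low hli).2
      have hd : X.dim i = X.dim j := by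
        rw [h.dim_eq_of_low hli, X.dim_eq_of_boundary_ne_zero hv (r := l) (by rwa [hb])]
      refine ⟨v + s • v', ?_, ?_, ?_⟩
      · refine add_mem hv (Submodule.smul_mem _ _ ?_)
        rw [← hd]
        exact X.chains_mono (by have := Fin.lt_def.1 hi; omega) _ hv'
      · have : v' j = 0 := by
          by_contra h0
          have := (hv' j h0).1
          have := Fin.lt_def.1 hi
          omega
        simp [hv1, this]
      · rw [map_add, map_smul, hb, hb']
        rfl)
    ⟨Pi.single j 1, X.single_mem_chains (Nat.lt_succ_self _) 1, by simp, by
      rw [X.boundary_single]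
      funext r
      exact (h.untouched j le_rfl r).symm⟩
  have key : ∀ i : Fin N, i.val < j.val + 1 → i ≠ j → i.val < j.val := by
    intro i hi hij
    have := Fin.val_ne_of_ne hij
    omega
  refine ⟨v, o, c, h1, ?_, ?_, ?_, ?_, ?_⟩
  · intro i hi r
    rw [Matrix.updateCol_ne (by rintro rfl; omega), h.untouched i (by omega)]
  · intro i hi hd
    by_cases hij : i = j
    · subst hij
      exact ⟨u, hu1, hu2, by simpa using hu3⟩
    · simpa [Matrix.updateCol_ne hij] using h.eq_boundary i (key i hi hij) hd
  · intro i hi hd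
    by_cases hij : i = j
    · subst hij
      simpa using h4
    · simpa [Matrix.updateCol_ne hij, hij] using h.isPivot i (key i hi hij) hd
  · intro i hi
    have hij : i ≠ j := by rintro rfl; omega
    rw [Function.update_of_ne hij]
    exact h.low_eq_none i (by omega)
  · have hlt : ∀ i l, o = some l → low i = some l → False := fun i l ho hl =>
      h5 l ho i (Fin.lt_def.2 (h.lt_of_low hl).1) hl
    intro i i' l hi hi'
    by_cases hij : i = j
    · by_cases hij' : i' = j
      · rw [hij, hij']
      · rw [hij, Function.update_self] at hi
        rw [Function.update_of_ne hij'] at hi'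
        exact (hlt _ _ hi hi').elim
    · by_cases hij' : i' = j
      · rw [hij', Function.update_self] at hi'
        rw [Function.update_of_ne hij] at hi
        exact (hlt _ _ hi' hi).elim
      · rw [Function.update_of_ne hij] at hi
        rw [Function.update_of_ne hij'] at hi'
        exact h.low_inj i i' l hi hi'

end Reduced

/-- Over a field, the reduction has gone on in the same way as over `ℤ` in the columns of dimension
at most `M + 1` among the first `n` columns. -/
structure Agrees {k : Type} [Field k] (X : FilteredComplex N) (M n : ℕ)
    (low : Fin N → Option (Fin N)) (B : Matrix (Fin N) (Fin N) ℤ)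
    (low' : Fin N → Option (Fin N)) (B' : Matrix (Fin N) (Fin N) k) : Prop where
  isPivotTable : IsPivotTable X.dim low' B'
  untouched : ∀ j : Fin N, n ≤ j.val → ∀ r, B' r j = X.incidence r j
  low_eq : ∀ j : Fin N, j.val < n → X.dim j ≤ M + 1 → low' j = low j
  col_eq : ∀ j : Fin N, j.val < n → X.dim j ≤ M + 1 → ∀ r, B' r j = B r j

namespace Agrees

variable {k : Type} [Field k]

theorem initial : X.Agrees M 0 (fun _ => none) X.incidence (fun _ => none)
    (X.incidence.map (Int.cast : ℤ → k)) where
  isPivotTable := X.isPivotTable_initial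
  untouched := fun _ _ _ => rfl
  low_eq := by simp
  col_eq := by simp

variable [DecidableEq k] {low' : Fin N → Option (Fin N)} {B' : Matrix (Fin N) (Fin N) k}

/-- The field algorithm also reduces the cells that the test leaves out; this costs time but touches
none of the compared columns. -/
theorem skip {j : Fin N} (h : X.Agrees M j.val low B low' B') (hj : M + 1 < X.dim j) :
    ∃ x c, FieldChoice.reduceColumn low' j (N + 1) B' = done x c ∧
      X.Agrees M (j.val + 1) low B (Function.update low' j x.2) x.1 := by
  obtain ⟨v, o, c, h1, -⟩ := reduceColumn_halts low' j B'
    (fun _ => True) (fun i _ l hl a => div_mul_cancel₀ a (h.isPivotTable.isPivot i l hl).1)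
    (fun i _ l hl => (h.isPivotTable.isPivot i l hl).2) (by simp) trivial
  obtain ⟨x, d, h2, -, h3⟩ := h.isPivotTable.reduceColumn j
  -- One description of the run shows that only column `j` changes, the other keeps the pivot table;
  -- they describe the same result.
  obtain ⟨rfl, -⟩ := done_injective (h1.symm.trans h2)
  refine ⟨_, c, h1, h3, ?_, ?_, ?_⟩
  · intro i hi r
    dsimp only
    rw [Matrix.updateCol_ne (by rintro rfl; omega), h.untouched i (by omega)]
  · intro i hi hd
    have hij : i ≠ j := by rintro rfl; omega
    have := Fin.val_ne_of_ne hij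
    rw [Function.update_of_ne hij, h.low_eq i (by omega) hd]
  · intro i hi hd r
    have hij : i ≠ j := by rintro rfl; omega
    have := Fin.val_ne_of_ne hij
    dsimp only
    rw [Matrix.updateCol_ne hij, h.col_eq i (by omega) hd]

theorem reduceColumn [CharZero k] {j : Fin N} (h : X.Agrees M j.val low B low' B')
    (hR : X.Reduced M j.val low B) (hu : UnitPivots low B) (hj : X.dim j ≤ M + 1)
    {v : Fin N → ℤ} {o : Option (Fin N)} {c : ℕ}
    (hrun : FieldChoice.reduceColumn low j (N + 1) B = done (B.updateCol j v, o) c) :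
    ∃ C, FieldChoice.reduceColumn low' j (N + 1) B' = done (C, o) c ∧
      X.Agrees M (j.val + 1) (Function.update low j o) (B.updateCol j v)
        (Function.update low' j o) C := by
  have h1 : FieldChoice.reduceColumn low' j (N + 1) B' =
      done (B'.updateCol j fun r => ((v r : ℤ) : k), o) c := by
    -- Restricting to the rows of this dimension excludes the high-dimensional columns, which have
    -- pivots over the field but no entry in the table of the test.
    rw [reduceColumn_map (Int.castRingHom k) Int.cast_injective {r | X.dim r + 1 = X.dim j}
      low low' j (N + 1) B B', hrun, map_done]
    · simp
    · intro l hl i hi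
      by_cases hd : X.dim i ≤ M + 1
      · rw [h.low_eq i hi hd]
      · constructor
        · intro h0
          exact absurd (hR.lt_of_low h0).2 hd
        · intro h0
          have := h.isPivotTable.dim_eq l i (h.isPivotTable.isPivot i l h0).1
          have hl : X.dim l + 1 = X.dim j := hl
          omega
    · intro l _ i hi hli r
      exact h.col_eq i hi (hR.lt_of_low hli).2 r
    · intro l _ i hi hli a
      -- Integer division commutes with the cast here only because the divisor is ±1.
      rcases Int.isUnit_iff.1 (hu i l hli) with h | h <;> simp [h, div_neg]
    · intro l hl i hi hli r hr
      have h2 := hR.dim_eq hi (hR.lt_of_low hli).2 hr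
      have h3 := hR.dim_eq_of_low hli
      have hl : X.dim l + 1 = X.dim j := hl
      exact show X.dim r + 1 = X.dim j by omega
    · intro r
      rw [h.untouched j le_rfl, hR.untouched j le_rfl]
      simp
    · intro r hr
      rw [hR.untouched j le_rfl] at hr
      exact (X.dim_eq r j hr).symm
  obtain ⟨x, d, h2, -, h3⟩ := h.isPivotTable.reduceColumn j
  obtain ⟨rfl, -⟩ := done_injective (h1.symm.trans h2)
  refine ⟨_, h1, h3, ?_, ?_, ?_⟩
  · intro i hi r
    rw [Matrix.updateCol_ne (by rintro rfl; omega), h.untouched i (by omega)]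
  · intro i hi hd
    by_cases hij : i = j
    · subst hij; simp
    · have := Fin.val_ne_of_ne hij
      rw [Function.update_of_ne hij, Function.update_of_ne hij, h.low_eq i (by omega) hd]
  · intro i hi hd r
    by_cases hij : i = j
    · subst hij; simp
    · have := Fin.val_ne_of_ne hij
      rw [Matrix.updateCol_ne hij, Matrix.updateCol_ne hij, h.col_eq i (by omega) hd]

end Agrees

/-- The state at the end of a run that returns "dependent": column `j` is the first one whose pivot
is not a unit. -/
def StopsAt (X : FilteredComplex N) (M : ℕ) (j l : Fin N) (low : Fin N → Option (Fin N))
    (B : Matrix (Fin N) (Fin N) ℤ) : Prop :=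
  X.Reduced M (j.val + 1) low B ∧ low j = some l ∧ ¬ IsUnit (B l j) ∧
    ∀ i s, i ≠ j → low i = some s → IsUnit (B s i)

theorem UnitPivots.update {j : Fin N} {v : Fin N → ℤ} {o : Option (Fin N)}
    (hu : UnitPivots low B) (h : ∀ l, o = some l → IsUnit (v l)) :
    UnitPivots (Function.update low j o) (B.updateCol j v) := by
  intro i l hl
  by_cases hij : i = j
  · subst hij
    simpa using h l (by simpa using hl)
  · rw [Matrix.updateCol_ne hij]
    exact hu i l (by simpa [hij] using hl)

/-- Correctness and cost follow from a single induction on the number `d` of columns left, with the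
field run carried along in lockstep. -/
theorem testLoop_spec (d : ℕ) (hd : n + d = N) (hR : X.Reduced M n low B)
    (hu : UnitPivots low B) :
    ∃ v c, testLoop X.dim M ((List.finRange N).drop n) low B = done v c ∧
      (v = Verdict.independent → ∃ low B, X.Reduced M N low B ∧ UnitPivots low B) ∧
      (∀ p, v = Verdict.dependent p → ∃ j l low B, X.StopsAt M j l low B ∧
        p = (B l j).natAbs) ∧
      ∀ (k : Type) [Field k] [CharZero k] [DecidableEq k] (low' : Fin N → Option (Fin N))
        (B' : Matrix (Fin N) (Fin N) k), X.Agrees M n low B low' B' →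
        ∃ x c', pdLoop ((List.finRange N).drop n) low' B' = done x c' ∧ c ≤ 4 * c' := by
  induction d generalizing n low B with
  | zero =>
    obtain rfl : n = N := by omega
    rw [show (List.finRange n).drop n = [] from List.drop_eq_nil_of_le (by simp)]
    refine ⟨_, 0, rfl, fun _ => ⟨low, B, hR, hu⟩, ?_, ?_⟩
    · rintro p ⟨⟩
    · intro k _ _ _ low' B' _
      exact ⟨_, 0, rfl, le_rfl⟩
  | succ d ih =>
    have hn : n < N := by omega
    obtain ⟨j, rfl⟩ : ∃ j : Fin N, n = j.val := ⟨⟨n, hn⟩, rfl⟩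
    rw [drop_finRange j]
    by_cases hj : X.dim j ≤ M + 1
    · obtain ⟨v, o, c, hrun, hR'⟩ := Reduced.reduceColumn hR hu hj
      by_cases ho : ∀ l, o = some l → IsUnit (v l)
      · obtain ⟨w, e, h1, h2, h3, h4⟩ := ih (by omega) hR' (hu.update ho)
        -- The overhead per column is at most one dimension test, two comparisons with ±1 and one
        -- table entry. The field run spends one operation on its table entry, whence the factor 4.
        have : ∃ e' ≤ c + 4 + e, testLoop X.dim M (j :: (List.finRange N).drop (j.val + 1)) low B =
            done w e' := by
          cases o with
          | none =>
            refine ⟨1 + (c + (1 + e)), by omega, ?_⟩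
            simp only [testLoop, hj, decide_true, tick_bind, if_true, hrun, done_bind, h1,
              delay_done]
          | some l =>
            refine ⟨1 + (c + (1 + (1 + (1 + e)))), by omega, ?_⟩
            have hb : (decide (v l = 1) || decide (v l = -1)) = true := by
              simpa using Int.isUnit_iff.1 (ho l rfl)
            simp only [testLoop, hj, decide_true, tick_bind, if_true, hrun, done_bind, h1,
              delay_done, Matrix.updateCol_self, hb]
        obtain ⟨e', he', h5⟩ := this
        refine ⟨w, e', h5, h2, h3, ?_⟩
        intro k _ _ _ low' B' hA
        obtain ⟨C, h6, h7⟩ := Agrees.reduceColumn hA hR hu hj hrun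
        obtain ⟨x, c', h8, h9⟩ := h4 k _ _ h7
        refine ⟨x, c + (1 + c'), ?_, by omega⟩
        simp only [pdLoop, h6, done_bind, tick_bind, h8, delay_done]
      · push Not at ho
        obtain ⟨l, rfl, hl⟩ := ho
        have hb : (decide (v l = 1) || decide (v l = -1)) = false := by
          rw [Int.isUnit_iff] at hl
          simpa using hl
        refine ⟨.dependent (v l).natAbs, 1 + (c + (1 + (1 + 1))), ?_, ?_, ?_, ?_⟩
        · simp only [testLoop, hj, decide_true, tick_bind, if_true, hrun, done_bind,
            delay_done, Matrix.updateCol_self, hb, pure_eq_done, Bool.false_eq_true, if_false]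
        · rintro ⟨⟩
        · rintro p ⟨⟩
          refine ⟨j, l, _, _, ⟨hR', by simp, by simpa using hl, ?_⟩, by simp⟩
          intro i s hij hs
          rw [Matrix.updateCol_ne hij]
          exact hu i s (by simpa [hij] using hs)
        · intro k _ _ _ low' B' hA
          obtain ⟨C, h6, h7⟩ := Agrees.reduceColumn hA hR hu hj hrun
          -- The test has stopped, but the field run goes on; all that is needed of the rest is that
          -- it halts.
          obtain ⟨x, c', h8, -⟩ := h7.isPivotTable.pdLoop ((List.finRange N).drop (j.val + 1))
          refine ⟨x, c + (1 + c'), ?_, by omega⟩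
          simp only [pdLoop, h6, done_bind, tick_bind, h8, delay_done]
    · obtain ⟨w, e, h1, h2, h3, h4⟩ := ih (by omega) (Reduced.skip hR (by omega)) hu
      refine ⟨w, 1 + e, ?_, h2, h3, ?_⟩
      · simp only [testLoop, hj, decide_false, tick_bind, h1, delay_done, Bool.false_eq_true, if_false]
      · intro k _ _ _ low' B' hA
        obtain ⟨⟨C, o⟩, c, h6, h7⟩ := Agrees.skip hA (by omega)
        obtain ⟨x, c', h8, h9⟩ := h4 k _ _ h7
        refine ⟨x, c + (1 + c'), ?_, by omega⟩
        simp only [pdLoop, h6, done_bind, tick_bind]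
        rw [h8, delay_done, delay_done]

end FilteredComplex

/-! ### Linear algebra over the integers -/

/-- Going down from the last row, each vanishing entry forces the term with that leading row to
vanish, so at `l` only the term of `l` survives. -/
theorem echelon_apply {N : ℕ} {b : Fin N → Fin N → ℤ} (hb : ∀ r s, r < s → b r s = 0)
    (hb' : ∀ r, b r = 0 ∨ b r r ≠ 0) (a : Fin N → ℤ) (l : Fin N)
    (h : ∀ s, l < s → (∑ r, a r • b r) s = 0) : (∑ r, a r • b r) l = a l * b l l := by
  have key : ∀ s, (∀ r, s < r → a r • b r = 0) → (∑ r, a r • b r) s = a s * b s s := by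
    intro s hs
    rw [Finset.sum_apply, Finset.sum_eq_single s]
    · simp
    · intro r _ hr
      rcases lt_or_gt_of_ne hr with hr | hr
      · simp [hb r s hr]
      · simpa using congrFun (hs r hr) s
    · simp
  refine key l fun r hr => ?_
  induction r using WellFoundedGT.induction with
  | ind r ih =>
    have h1 := key r fun t ht => ih t ht (hr.trans ht)
    rw [h r hr] at h1
    rcases hb' r with h2 | h2
    · simp [h2]
    · rcases mul_eq_zero.1 h1.symm with h3 | h3
      · simp [h3]
      · exact absurd h3 h2

/-- A finitely generated abelian group with a cyclic subgroup of order `p` and torsion-free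
quotient by this subgroup. -/
theorem exists_equiv_zmod_prod {G : Type*} [AddCommGroup G] [Module.Finite ℤ G] (g : G) (p : ℕ)
    (hg : ∀ k : ℤ, k • g = 0 ↔ (p : ℤ) ∣ k)
    (hG : ∀ (k : ℤ) (y : G), k ≠ 0 → k • y ∈ Submodule.span ℤ {g} → y ∈ Submodule.span ℤ {g}) :
    ∃ r : ℕ, Nonempty (G ≃ₗ[ℤ] ZMod p × (Fin r → ℤ)) := by
  let S := Submodule.span ℤ {g}
  have : Module.IsTorsionFree ℤ (G ⧸ S) := by
    refine Module.IsTorsionFree.of_smul_eq_zero fun k y hy => ?_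
    induction y using Submodule.Quotient.induction_on with
    | _ y =>
      by_contra! h
      rw [← Submodule.Quotient.mk_smul, Submodule.Quotient.mk_eq_zero] at hy
      exact h.2 ((Submodule.Quotient.mk_eq_zero S).2 (hG k y h.1 hy))
  have : Module.Free ℤ (G ⧸ S) := Module.free_of_finite_type_torsion_free'
  -- The quotient is free, hence projective; its section `h` and the map from `ZMod p` sending 1 to
  -- `g` together give the splitting.
  obtain ⟨h, hh⟩ := Module.projective_lifting_property S.mkQ LinearMap.id S.mkQ_surjective
  have hh' : ∀ w, S.mkQ (h w) = w := fun w => LinearMap.congr_fun hh w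
  let f : ZMod p →+ G := ZMod.lift p ⟨zmultiplesHom G g, by simpa using (hg p).2 dvd_rfl⟩
  have hf : ∀ k : ℤ, f k = k • g := fun k => by simp [f]
  have hfS : ∀ a, S.mkQ (f a) = 0 := by
    intro a
    obtain ⟨k, rfl⟩ := ZMod.intCast_surjective a
    rw [hf, Submodule.mkQ_apply, Submodule.Quotient.mk_eq_zero]
    exact Submodule.smul_mem _ _ (Submodule.mem_span_singleton_self g)
  let F : ZMod p × (G ⧸ S) →ₗ[ℤ] G := f.toIntLinearMap.coprod h
  have hF : ∀ a w, F (a, w) = f a + h w := fun a w => by simp [F]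
  have hbij : Function.Bijective F := by
    constructor
    · rw [← LinearMap.ker_eq_bot, LinearMap.ker_eq_bot']
      rintro ⟨a, w⟩ h0
      rw [hF] at h0
      have hw : w = 0 := by
        have := congrArg S.mkQ h0
        rwa [map_add, hfS, hh', zero_add, map_zero] at this
      subst hw
      obtain ⟨k, rfl⟩ := ZMod.intCast_surjective a
      rw [map_zero, add_zero, hf, hg, ← ZMod.intCast_zmod_eq_zero_iff_dvd] at h0
      rw [h0]
      rfl
    · intro y
      have : y - h (S.mkQ y) ∈ S := by
        rw [← Submodule.Quotient.mk_eq_zero, ← Submodule.mkQ_apply, map_sub, hh', sub_self]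
      obtain ⟨k, hk⟩ := Submodule.mem_span_singleton.1 this
      exact ⟨((k : ZMod p), S.mkQ y), by rw [hF, hf, hk]; abel⟩
  exact ⟨_, ⟨(LinearEquiv.ofBijective F hbij).symm.trans
    ((LinearEquiv.refl ℤ (ZMod p)).prodCongr (Module.finBasis ℤ (G ⧸ S)).equivFun)⟩⟩

namespace FilteredComplex

variable {N : ℕ} {X : FilteredComplex N} {M n' : ℕ} {low : Fin N → Option (Fin N)}
  {B : Matrix (Fin N) (Fin N) ℤ}

/-! ### Boundaries and reduced columns -/

namespace Reduced

/-- The chain that bounds to column `j` has coefficient 1 at `j`, so a suitable integral multiple of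
it removes the last cell of `d`. -/
theorem boundary_mem_span (h : X.Reduced M n' low B) {q : ℕ} (hq : q ≤ M) {t : ℕ} (ht : t ≤ n')
    {d : Fin N → ℤ} (hd : d ∈ X.chains t (q + 1)) :
    X.boundary d ∈ Submodule.span ℤ
      {w | ∃ i : Fin N, i.val < t ∧ X.dim i = q + 1 ∧ w = fun r => B r i} := by
  induction t generalizing d with
  | zero =>
    have : d = 0 := by
      ext i
      by_contra h0
      exact absurd (hd i h0).1 (Nat.not_lt_zero _)
    simp [this]
  | succ t ih =>
    have hmono : Submodule.span ℤ
        {w | ∃ i : Fin N, i.val < t ∧ X.dim i = q + 1 ∧ w = fun r => B r i} ≤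
        Submodule.span ℤ
        {w | ∃ i : Fin N, i.val < t + 1 ∧ X.dim i = q + 1 ∧ w = fun r => B r i} := by
      refine Submodule.span_mono ?_
      rintro w ⟨i, hi, hw⟩
      exact ⟨i, by omega, hw⟩
    by_cases hc : ∃ j : Fin N, j.val = t ∧ X.dim j = q + 1
    · obtain ⟨j, rfl, hj⟩ := hc
      obtain ⟨v, hv, hv1, hb⟩ := h.eq_boundary j (by omega) (by omega)
      have h1 : d - d j • v ∈ X.chains j.val (q + 1) := by
        have h2 : d - d j • v ∈ X.chains (j.val + 1) (q + 1) := by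
          rw [← hj] at hd ⊢
          exact sub_mem hd (Submodule.smul_mem _ _ hv)
        intro i hi
        have h3 := h2 i hi
        have : i ≠ j := by
          rintro rfl
          simp [hv1] at hi
        have := Fin.val_ne_of_ne this
        exact ⟨by omega, h3.2⟩
      have h2 := hmono (ih (by omega) h1)
      have h3 : X.boundary d = X.boundary (d - d j • v) + d j • fun r => B r j := by
        rw [map_sub, map_smul, hb]
        abel
      rw [h3]
      exact add_mem h2 (Submodule.smul_mem _ _ (Submodule.subset_span ⟨j, by omega, hj, rfl⟩))
    · refine hmono (ih (by omega) fun i hi => ?_)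
      have h1 := hd i hi
      have : i.val ≠ t := fun h0 => hc ⟨i, h0, h1.2⟩
      exact ⟨by omega, h1.2⟩

theorem col_mem_relBoundaries (h : X.Reduced M n' low B) {n m q : ℕ} (hq : q ≤ M) (hn : n ≤ n')
    {i : Fin N} (hi : i.val < n) (hd : X.dim i = q + 1) :
    (fun r => B r i) ∈ X.relBoundaries n m q := by
  obtain ⟨v, hv, -, hb⟩ := h.eq_boundary i (by omega) (by omega)
  rw [← hb]
  refine Submodule.mem_sup_left (Submodule.mem_map_of_mem ?_)
  rw [← hd]
  exact X.chains_mono (by omega) _ hv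

/-- The relative boundaries have a basis in echelon form, which consists of reduced columns and of
cells. -/
theorem relBoundaries_eq_span (h : X.Reduced M n' low B) {n q : ℕ} (hq : q ≤ M) (hn : n ≤ n')
    (m : ℕ) :
    ∃ b : Fin N → Fin N → ℤ, X.relBoundaries n m q = Submodule.span ℤ (Set.range b) ∧
      (∀ r s, r < s → b r s = 0) ∧
      ∀ r, b r = 0 ∨ (r.val < m ∧ b r r = 1) ∨ (m ≤ r.val ∧ ∃ i : Fin N, i.val < n ∧ low i = some r ∧
        b r = fun s => B s i) := by
  classical
  let Q : Fin N → Fin N → Prop := fun r i => i.val < n ∧ X.dim i = q + 1 ∧ low i = some r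
  let b : Fin N → Fin N → ℤ := fun r =>
    if r.val < m then if X.dim r = q then Pi.single r 1 else 0
    else if hr : ∃ i, Q r i then fun s => B s hr.choose else 0
  have hb1 : ∀ r, r.val < m → X.dim r = q → b r = Pi.single r 1 := by
    intro r h1 h2
    simp [b, h1, h2]
  have hb2 : ∀ r, r.val < m → X.dim r ≠ q → b r = 0 := by
    intro r h1 h2
    simp [b, h1, h2]
  have hb3 : ∀ r, ¬ r.val < m → ∀ i, Q r i → b r = fun s => B s i := by
    intro r h1 i hi
    have hr : ∃ i, Q r i := ⟨i, hi⟩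
    have : hr.choose = i := h.low_inj _ _ r hr.choose_spec.2.2 hi.2.2
    simp only [b, h1, if_false, hr, dif_pos, this]
  have hb4 : ∀ r, ¬ r.val < m → (¬ ∃ i, Q r i) → b r = 0 := by
    intro r h1 h2
    simp only [b, h1, if_false, h2, dif_neg, not_false_eq_true]
  have hcell : X.chains m q ≤ Submodule.span ℤ (Set.range b) := by
    intro c hc
    rw [show c = ∑ r, c r • Pi.single r (1 : ℤ) by
      ext s; simp [Finset.sum_apply, Pi.single_apply]]
    refine Submodule.sum_mem _ fun r _ => ?_
    by_cases hr : c r = 0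
    · simp [hr]
    · rw [← hb1 r (hc r hr).1 (hc r hr).2]
      exact Submodule.smul_mem _ _ (Submodule.subset_span ⟨r, rfl⟩)
  refine ⟨b, le_antisymm (sup_le ?_ hcell) (Submodule.span_le.2 ?_), ?_, ?_⟩
  · rintro _ ⟨d, hd, rfl⟩
    refine Submodule.span_le.2 ?_ (h.boundary_mem_span hq hn hd)
    rintro _ ⟨i, hi, hdim, rfl⟩
    have hpiv := h.isPivot i (by omega) (by omega)
    cases ho : low i with
    | none =>
      rw [ho] at hpiv
      rw [show (fun r => B r i) = 0 from funext hpiv]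
      exact zero_mem _
    | some l =>
      rw [ho] at hpiv
      -- A column with pivot row below `m` is itself a chain of X_m, so it is redundant in the
      -- basis.
      by_cases hl : l.val < m
      · refine hcell fun r hr => ?_
        have h1 := h.dim_eq (by omega) (by omega) hr
        have h2 : ¬ l < r := fun h0 => hr (hpiv.2 r h0)
        rw [Fin.lt_def] at h2
        exact ⟨by omega, by omega⟩
      · rw [← hb3 l hl i ⟨hi, hdim, ho⟩]
        exact Submodule.subset_span ⟨l, rfl⟩
  · rintro _ ⟨r, rfl⟩
    by_cases h1 : r.val < m
    · by_cases h2 : X.dim r = q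
      · rw [hb1 r h1 h2]
        refine Submodule.mem_sup_right ?_
        rw [← h2]
        exact X.single_mem_chains h1 1
      · rw [hb2 r h1 h2]
        exact zero_mem _
    · by_cases h2 : ∃ i, Q r i
      · obtain ⟨i, hi⟩ := h2
        rw [hb3 r h1 i hi]
        exact h.col_mem_relBoundaries hq hn hi.1 hi.2.1
      · rw [hb4 r h1 h2]
        exact zero_mem _
  · intro r s hrs
    by_cases h1 : r.val < m
    · by_cases h2 : X.dim r = q
      · rw [hb1 r h1 h2, Pi.single_eq_of_ne hrs.ne']
      · rw [hb2 r h1 h2]; rfl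
    · by_cases h2 : ∃ i, Q r i
      · obtain ⟨i, hi⟩ := h2
        rw [hb3 r h1 i hi]
        exact (h.isPivot_of_low hi.2.2).2 s hrs
      · rw [hb4 r h1 h2]; rfl
  · intro r
    by_cases h1 : r.val < m
    · by_cases h2 : X.dim r = q
      · exact Or.inr (Or.inl ⟨h1, by rw [hb1 r h1 h2, Pi.single_eq_same]⟩)
      · exact Or.inl (hb2 r h1 h2)
    · by_cases h2 : ∃ i, Q r i
      · obtain ⟨i, hi⟩ := h2
        exact Or.inr (Or.inr ⟨by omega, i, hi.1, hi.2.2, hb3 r h1 i hi⟩)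
      · exact Or.inl (hb4 r h1 h2)

/-- The leading coefficient of a relative boundary is a multiple of a pivot or of `1`. -/
theorem exists_dvd_of_mem_relBoundaries (h : X.Reduced M n' low B) {n m q : ℕ} (hq : q ≤ M)
    (hn : n ≤ n') {x : Fin N → ℤ} (hx : x ∈ X.relBoundaries n m q) {l : Fin N}
    (hl : IsPivot x (some l)) :
    ∃ b ∈ X.relBoundaries n m q, b l ∣ x l ∧ (∀ s, l < s → b s = 0) ∧
      ((l.val < m ∧ b l = 1) ∨ (m ≤ l.val ∧ ∃ i : Fin N, i.val < n ∧ low i = some l ∧ b l = B l i)) := by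
  obtain ⟨b, h1, h2, h3⟩ := h.relBoundaries_eq_span hq hn m
  rw [h1] at hx ⊢
  obtain ⟨a, rfl⟩ := (Submodule.mem_span_range_iff_exists_fun ℤ).1 hx
  have h4 := echelon_apply h2 (by
    intro r
    rcases h3 r with h0 | ⟨-, h0⟩ | ⟨-, i, -, hi, h0⟩
    · exact Or.inl h0
    · exact Or.inr (by simp [h0])
    · refine Or.inr ?_
      rw [h0]
      exact (h.isPivot_of_low hi).1) a l hl.2
  refine ⟨b l, Submodule.subset_span ⟨l, rfl⟩, ⟨a l, by rw [h4, mul_comm]⟩, h2 l, ?_⟩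
  rcases h3 l with h0 | h0 | ⟨hm, i, hi, hli, h0⟩
  · exact absurd h4 (by simpa [h0] using hl.1)
  · exact Or.inl h0
  · exact Or.inr ⟨hm, i, hi, hli, by rw [h0]⟩

/-- If the pivots in the rows from `m` on are units, the group of relative boundaries is pure. -/
theorem mem_relBoundaries_of_smul_mem (h : X.Reduced M n' low B) {n m q : ℕ} (hq : q ≤ M)
    (hn : n ≤ n')
    (hu : ∀ i l : Fin N, i.val < n → m ≤ l.val → low i = some l → IsUnit (B l i))
    {a : ℤ} (ha : a ≠ 0) {c : Fin N → ℤ} (hc : a • c ∈ X.relBoundaries n m q) :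
    c ∈ X.relBoundaries n m q := by
  suffices H : ∀ t : ℕ, ∀ c : Fin N → ℤ, (∀ r : Fin N, t ≤ r.val → c r = 0) →
      a • c ∈ X.relBoundaries n m q → c ∈ X.relBoundaries n m q from
    H N c (fun r hr => absurd r.isLt (by omega)) hc
  intro t
  induction t with
  | zero =>
    intro c hc _
    rw [show c = 0 from funext fun r => hc r (Nat.zero_le _)]
    exact zero_mem _
  | succ t ih =>
    intro c hc hac
    by_cases hl : ∃ l : Fin N, l.val = t ∧ c l ≠ 0
    · obtain ⟨l, rfl, hl⟩ := hl
      obtain ⟨b, hb, -, hb0, hb1⟩ := h.exists_dvd_of_mem_relBoundaries hq hn hac (l := l)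
        ⟨by simp [ha, hl], fun s hs => by simp [hc s (by have := Fin.lt_def.1 hs; omega)]⟩
      have hbu : IsUnit (b l) := by
        rcases hb1 with ⟨-, hb1⟩ | ⟨hm, i, hi, hli, hb1⟩
        · simp [hb1]
        · rw [hb1]
          exact hu i l hi hm hli
      obtain ⟨u, hu'⟩ := hbu.exists_left_inv
      -- Since `u` inverts the leading coefficient of `b`, this cancels the leading entry of `c`
      -- without dividing by `a`.
      have h1 : c - (c l * u) • b ∈ X.relBoundaries n m q := by
        apply ih
        · intro r hr
          rcases eq_or_lt_of_le hr with h0 | h0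
          · obtain rfl : l = r := Fin.ext h0
            simp [mul_assoc, hu']
          · simp [hc r h0, hb0 r (Fin.lt_def.2 h0)]
        · rw [smul_sub]
          exact sub_mem hac (Submodule.smul_mem _ _ (Submodule.smul_mem _ _ hb))
      have h2 := add_mem h1 (Submodule.smul_mem _ (c l * u) hb)
      simpa using h2
    · refine ih c (fun r hr => ?_) hac
      rcases eq_or_lt_of_le hr with h0 | h0
      · by_contra h1
        exact hl ⟨r, h0.symm, h1⟩
      · exact hc r h0

theorem free_relHomology (h : X.Reduced M n' low B) {n m q : ℕ} (hq : q ≤ M)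
    (hn : n ≤ n') (hu : UnitPivots low B) : Module.Free ℤ (X.RelHomology n m q) := by
  have : Module.IsTorsionFree ℤ (X.RelHomology n m q) := by
    refine Module.IsTorsionFree.of_smul_eq_zero fun a y hy => ?_
    induction y using Submodule.Quotient.induction_on with
    | _ y =>
      by_contra! h0
      rw [← Submodule.Quotient.mk_smul, Submodule.Quotient.mk_eq_zero] at hy
      refine h0.2 ((Submodule.Quotient.mk_eq_zero _).2 ?_)
      exact h.mem_relBoundaries_of_smul_mem hq hn (fun i l _ _ hl => hu i l hl) h0.1 hy
  exact Module.free_of_finite_type_torsion_free'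

end Reduced

/-! ### Torsion at the first pivot that is not a unit -/

/-- X_{l+1} has just the cell `l` in addition to X_l. Thus working modulo the class of `l` is the
same as taking boundaries relative to X_{l+1}. -/
theorem mem_relBoundaries_succ {n q : ℕ} {l : Fin N} (hl : X.dim l = q) {x : Fin N → ℤ} :
    x ∈ X.relBoundaries n (l.val + 1) q ↔
      ∃ a : ℤ, x - a • Pi.single l 1 ∈ X.relBoundaries n l.val q := by
  constructor
  · intro hx
    obtain ⟨y, hy, c, hc, rfl⟩ := Submodule.mem_sup.1 hx
    refine ⟨c l, ?_⟩
    rw [add_sub_assoc]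
    refine add_mem (Submodule.mem_sup_left hy) (Submodule.mem_sup_right fun i hi => ?_)
    have hil : i ≠ l := by rintro rfl; simp at hi
    have h1 := hc i (by simpa [hil] using hi)
    have := Fin.val_ne_of_ne hil
    exact ⟨by omega, h1.2⟩
  · rintro ⟨a, ha⟩
    have h1 : X.relBoundaries n l.val q ≤ X.relBoundaries n (l.val + 1) q :=
      sup_le_sup_left (X.chains_mono (Nat.le_succ _) q) _
    have h2 : a • Pi.single l 1 ∈ X.relBoundaries n (l.val + 1) q := by
      refine Submodule.smul_mem _ _ (Submodule.mem_sup_right ?_)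
      rw [← hl]
      exact X.single_mem_chains (Nat.lt_succ_self _) 1
    simpa using add_mem (h1 ha) h2

theorem single_mem_relCycles {n : ℕ} {l : Fin N} (hl : l.val < n) :
    Pi.single l 1 ∈ X.relCycles n l.val (X.dim l) := by
  refine ⟨X.single_mem_chains hl 1, fun r hr => ?_⟩
  rw [X.boundary_single] at hr
  exact Fin.lt_def.1 (X.lt r l hr)

/-- At the first pivot `p ≠ ±1`, in row `l` and column `j`, the cell `l` generates a direct summand
of order `|p|` of the homology of `(X_{j + 1}, X_l)`, with free complement. -/
theorem StopsAt.exists_equiv {j l : Fin N} (h : X.StopsAt M j l low B) :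
    2 ≤ (B l j).natAbs ∧ ∃ m n q r : ℕ, m < n ∧ n ≤ N ∧ q ≤ M ∧
      Nonempty (X.RelHomology n m q ≃ₗ[ℤ] ZMod (B l j).natAbs × (Fin r → ℤ)) := by
  obtain ⟨hR, hlow, hnu, hu⟩ := h
  have hpiv := hR.isPivot_of_low hlow
  have hdim := hR.dim_eq_of_low hlow
  have hq : X.dim l ≤ M := by
    have := (hR.lt_of_low hlow).2
    omega
  have hlj : l.val < j.val + 1 := by
    obtain ⟨v, hv, -, hb⟩ := hR.eq_boundary j (by omega) (by omega)
    have h1 : X.boundary v l ≠ 0 := by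
      rw [hb]
      exact hpiv.1
    rw [boundary_apply] at h1
    obtain ⟨i, -, hi⟩ := Finset.exists_ne_zero_of_sum_ne_zero h1
    have h2 := Fin.lt_def.1 (X.lt l i (left_ne_zero_of_mul hi))
    have h3 := (hv i (right_ne_zero_of_mul hi)).1
    omega
  have hp2 : 2 ≤ (B l j).natAbs := by
    have h1 : B l j ≠ 0 := hpiv.1
    rw [Int.isUnit_iff] at hnu
    omega
  have hpmem : (B l j) • Pi.single l 1 ∈ X.relBoundaries (j.val + 1) l.val (X.dim l) := by
    have h1 := hR.col_mem_relBoundaries (m := l.val) hq le_rfl (Nat.lt_succ_self j.val) hdim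
    -- Below its pivot entry, column `j` lives on cells that precede `l`, hence in X_l.
    have h2 : (fun r => B r j) - (B l j) • Pi.single l 1 ∈
        X.relBoundaries (j.val + 1) l.val (X.dim l) := by
      refine Submodule.mem_sup_right fun i hi => ?_
      have hil : i ≠ l := by rintro rfl; simp at hi
      have hi' : B i j ≠ 0 := by simpa [hil] using hi
      have h3 := hR.dim_eq (by omega) (by omega) hi'
      have h4 : ¬ l < i := fun h0 => hi' (hpiv.2 i h0)
      have := Fin.val_ne_of_ne hil
      rw [Fin.lt_def] at h4
      exact ⟨by omega, by omega⟩
    simpa using sub_mem h1 h2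
  have hord : ∀ a : ℤ, a • Pi.single l 1 ∈ X.relBoundaries (j.val + 1) l.val (X.dim l) ↔
      ((B l j).natAbs : ℤ) ∣ a := by
    intro a
    rw [Int.natAbs_dvd]
    constructor
    · intro ha
      by_cases h0 : a = 0
      · simp [h0]
      obtain ⟨b, -, hb, -, hb1⟩ := hR.exists_dvd_of_mem_relBoundaries hq le_rfl ha (l := l)
        ⟨by simp [h0], fun s hs => by simp [hs.ne']⟩
      -- The row `l` does not belong to X_l, so the divisor is a pivot; pivot rows being distinct,
      -- it is that of column `j`.
      rcases hb1 with ⟨h1, -⟩ | ⟨-, i, -, hi, hb1⟩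
      · exact absurd h1 (lt_irrefl _)
      · rw [hb1, hR.low_inj i j l hi hlow] at hb
        simpa using hb
    · rintro ⟨a, rfl⟩
      rw [mul_comm, mul_smul]
      exact Submodule.smul_mem _ _ hpmem
  let g : X.RelHomology (j.val + 1) l.val (X.dim l) :=
    Submodule.Quotient.mk ⟨_, X.single_mem_relCycles hlj⟩
  have hmk : ∀ (c : X.relCycles (j.val + 1) l.val (X.dim l)) (k a : ℤ),
      (k • Submodule.Quotient.mk c = a • g ↔
        k • (c : Fin N → ℤ) - a • Pi.single l 1 ∈
          X.relBoundaries (j.val + 1) l.val (X.dim l)) := by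
    intro c k a
    rw [← sub_eq_zero, ← Submodule.Quotient.mk_smul, ← Submodule.Quotient.mk_smul,
      ← Submodule.Quotient.mk_sub, Submodule.Quotient.mk_eq_zero]
    rfl
  obtain ⟨r, hr⟩ := exists_equiv_zmod_prod g (B l j).natAbs
    (by
      intro k
      rw [← hord, ← zero_smul ℤ g, hmk]
      simp)
    (by
      intro k y hk hy
      induction y using Submodule.Quotient.induction_on with
      | _ y =>
        obtain ⟨a, ha⟩ := Submodule.mem_span_singleton.1 hy
        have h1 := (X.mem_relBoundaries_succ rfl).2 ⟨a, (hmk y k a).1 ha.symm⟩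
        -- Relative to X_{l+1} only pivots in rows after `l` count; this excludes column `j`, and
        -- all the others are units.
        have h2 := hR.mem_relBoundaries_of_smul_mem hq le_rfl (by
          intro i s _ hs hi
          refine hu i s ?_ hi
          rintro rfl
          rw [hlow] at hi
          cases hi
          omega) hk h1
        obtain ⟨b, hb⟩ := (X.mem_relBoundaries_succ rfl).1 h2
        refine Submodule.mem_span_singleton.2 ⟨b, ?_⟩
        have h3 := (hmk y 1 b).2 (by simpa using hb)
        rw [← h3, one_smul])
  exact ⟨hp2, l.val, j.val + 1, X.dim l, r, hlj, j.isLt, hq, hr⟩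

theorem not_free_of_equiv {n m q p r : ℕ} (hp : 2 ≤ p)
    (h : Nonempty (X.RelHomology n m q ≃ₗ[ℤ] ZMod p × (Fin r → ℤ))) :
    ¬ Module.Free ℤ (X.RelHomology n m q) := by
  intro hf
  obtain ⟨e⟩ := h
  have : Fact (1 < p) := ⟨hp⟩
  have h1 : (p : ℤ) • e.symm (1, 0) = 0 := by
    rw [← map_smul, Prod.smul_mk, smul_zero]
    simp
  rcases smul_eq_zero.1 h1 with h2 | h2
  · have : p = 0 := by exact_mod_cast h2
    omega
  · rw [LinearEquiv.map_eq_zero_iff] at h2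
    exact one_ne_zero (congrArg Prod.fst h2)

end FilteredComplex

/-! ### Graphs on which the reduction takes cubic time -/

namespace SlowGraph

variable (K : ℕ)

/-- The positions `j` of the edges: first the edges `{t, t + 1}` with `t < 2 * K` of a path, then
the edges `{t, 2 * K}` with `t < K`. All other positions belong to vertices. -/
def IsEdge (j : ℕ) : Prop := 2 * K < j ∧ j ≤ 5 * K

instance (j : ℕ) : Decidable (IsEdge K j) := inferInstanceAs (Decidable (_ ∧ _))

/-- The smaller vertex of an edge. -/
def source (j : ℕ) : ℕ := if j ≤ 4 * K then j - 2 * K - 1 else j - 4 * K - 1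

/-- The larger vertex of an edge. -/
def target (j : ℕ) : ℕ := if j ≤ 4 * K then j - 2 * K else 2 * K

variable {K}

theorem source_lt_target {j : ℕ} (h : IsEdge K j) : source K j < target K j := by
  unfold IsEdge at h
  unfold source target
  split_ifs <;> omega

theorem target_le {j : ℕ} (h : IsEdge K j) : target K j ≤ 2 * K := by
  unfold IsEdge at h
  unfold target
  split_ifs <;> omega

theorem edge_ext {i j : ℕ} (hi : IsEdge K i) (hj : IsEdge K j) (hs : source K i = source K j)
    (ht : target K i = target K j) : i = j := by
  unfold IsEdge at hi hj
  unfold source at hs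
  unfold target at ht
  split_ifs at hs ht <;> omega

variable (K)

/-- The simplex at position `j`. -/
def cell (j : ℕ) : Finset ℕ := if IsEdge K j then {source K j, target K j} else {j}

/-- The boundary of the edge `{a, b}` with `a < b`. -/
def edgeCol (R : Type) [Ring R] (N a b : ℕ) : Fin N → R := fun r =>
  (if r.val = b then 1 else 0) - if r.val = a then 1 else 0

/-- The boundary of the cell at position `j`. -/
def col (R : Type) [Ring R] (N j : ℕ) : Fin N → R :=
  if IsEdge K j then edgeCol R N (source K j) (target K j) else 0

variable {K}

theorem edgeCol_ne_zero {R : Type} [Ring R] {N a b : ℕ} {r : Fin N} (h : edgeCol R N a b r ≠ 0) :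
    r.val = a ∨ r.val = b := by
  by_contra! h0
  simp [edgeCol, h0] at h

theorem of_col_ne_zero {R : Type} [Ring R] {N j : ℕ} {r : Fin N} (h : col K R N j r ≠ 0) :
    IsEdge K j ∧ r.val ≤ 2 * K := by
  by_cases hj : IsEdge K j
  · refine ⟨hj, ?_⟩
    simp only [col, hj, if_true] at h
    have h1 := source_lt_target hj
    have h2 := target_le hj
    rcases edgeCol_ne_zero h with h3 | h3 <;> omega
  · simp [col, hj] at h

variable (K)

/-- The graph as a filtered complex. -/
def graph (N : ℕ) : FilteredComplex N where
  dim j := if IsEdge K j then 1 else 0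
  incidence := Matrix.of fun i j => col K ℤ N j i
  dim_eq i j h := by
    obtain ⟨h1, h2⟩ := of_col_ne_zero h
    have h3 : ¬ IsEdge K i := fun h3 => by unfold IsEdge at h3; omega
    simp [h1, h3]
  lt i j h := by
    obtain ⟨h1, h2⟩ := of_col_ne_zero h
    rw [Fin.lt_def]
    unfold IsEdge at h1
    omega
  sq_zero := by
    ext i j
    rw [Matrix.mul_apply]
    refine Finset.sum_eq_zero fun k _ => ?_
    by_contra h
    have h1 := (of_col_ne_zero (right_ne_zero_of_mul h)).2
    have h2 := (of_col_ne_zero (left_ne_zero_of_mul h)).1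
    unfold IsEdge at h2
    omega

theorem dim_graph_le {N : ℕ} (j : Fin N) (M : ℕ) : (graph K N).dim j ≤ M + 1 := by
  simp only [graph]
  split_ifs <;> omega

/-! ### The graph is a simplicial complex -/

variable {K}

theorem card_cell (j : ℕ) : (cell K j).card = if IsEdge K j then 2 else 1 := by
  unfold cell
  split_ifs with h
  · exact Finset.card_pair (source_lt_target h).ne
  · simp

theorem cell_eq_singleton {i c : ℕ} (hc : ¬ IsEdge K c) : cell K i = {c} ↔ i = c := by
  constructor
  · intro h
    have h1 := card_cell (K := K) i
    rw [h, Finset.card_singleton] at h1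
    by_cases hi : IsEdge K i
    · simp [hi] at h1
    · simpa [cell, hi] using h
  · rintro rfl
    simp [cell, hc]

theorem not_isEdge {c : ℕ} (h : c ≤ 2 * K) : ¬ IsEdge K c := by
  unfold IsEdge
  omega

theorem cell_injective : Function.Injective (cell K) := by
  intro i j h
  by_cases hj : IsEdge K j
  · have hi : IsEdge K i := by
      have h1 := card_cell (K := K) i
      rw [h, card_cell, if_pos hj] at h1
      by_contra hi
      simp [hi] at h1
    have h1 := source_lt_target hi
    have h2 := source_lt_target hj
    simp only [cell, hi, hj, if_true] at h
    have h3 : source K i ∈ ({source K j, target K j} : Finset ℕ) := by rw [← h]; simp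
    have h4 : target K i ∈ ({source K j, target K j} : Finset ℕ) := by rw [← h]; simp
    simp only [Finset.mem_insert, Finset.mem_singleton] at h3 h4
    exact edge_ext hi hj (by omega) (by omega)
  · rw [show cell K j = {j} by simp [cell, hj]] at h
    exact (cell_eq_singleton hj).1 h

theorem isSimplicial_graph (N : ℕ) : (graph K N).IsSimplicial := by
  refine ⟨fun i => cell K i, fun i j h => Fin.ext (cell_injective h), ?_, ?_, ?_⟩
  · intro i
    rw [card_cell]
    simp only [graph]
    split_ifs <;> rfl
  · intro j s hs hsj
    by_cases hj : IsEdge K j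
    · have h1 := source_lt_target hj
      have h2 := target_le hj
      have h3 := hj.1
      have hjN := j.isLt
      -- The end points of edges are vertices at positions up to `2 * K`, before all edges.
      have hv : ∀ c, c ≤ 2 * K → s = {c} → ∃ i ≤ j, cell K i.val = s := fun c hc hsc =>
        ⟨⟨c, by omega⟩, Fin.le_def.2 (by simp only; omega), by
          rw [hsc]; exact (cell_eq_singleton (not_isEdge hc)).2 rfl⟩
      simp only [cell, hj, if_true] at hsj
      have hsub : s = {source K j} ∨ s = {target K j} ∨ s = {source K j, target K j} := by
        obtain ⟨x, hx⟩ := hs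
        grind
      rcases hsub with h | h | h
      · exact hv _ (by omega) h
      · exact hv _ (by omega) h
      · exact ⟨j, le_rfl, by simp [cell, hj, h]⟩
    · simp only [cell, hj, if_false] at hsj
      refine ⟨j, le_rfl, ?_⟩
      rcases Finset.subset_singleton_iff.1 hsj with h | h
      · simp [h] at hs
      · simp [cell, hj, h]
  · intro i j
    change col K ℤ N j i = ∑ v ∈ cell K j, if cell K i = (cell K j).erase v then
      (-1) ^ ((cell K j).filter (· < v)).card else 0
    by_cases hj : IsEdge K j
    · have h1 := source_lt_target hj
      have h2 := target_le hj
      have e1 : cell K j = {source K j, target K j} := by simp [cell, hj]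
      have e2 : ({source K j, target K j} : Finset ℕ).erase (source K j) = {target K j} := by
        ext x
        simp only [Finset.mem_erase, Finset.mem_insert, Finset.mem_singleton]
        omega
      have e3 : ({source K j, target K j} : Finset ℕ).erase (target K j) = {source K j} := by
        ext x
        simp only [Finset.mem_erase, Finset.mem_insert, Finset.mem_singleton]
        omega
      have e4 : ({source K j, target K j} : Finset ℕ).filter (· < source K j) = ∅ := by
        ext x
        simp only [Finset.mem_filter, Finset.mem_insert, Finset.mem_singleton,
          Finset.notMem_empty, iff_false]
        omega
      have e5 : ({source K j, target K j} : Finset ℕ).filter (· < target K j) =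
          {source K j} := by
        ext x
        simp only [Finset.mem_filter, Finset.mem_insert, Finset.mem_singleton]
        omega
      rw [e1, Finset.sum_pair h1.ne, e2, e3, e4, e5]
      simp only [cell_eq_singleton (not_isEdge h2),
        cell_eq_singleton (not_isEdge (h1.le.trans h2)), col, hj, if_true, edgeCol]
      split_ifs <;> simp
    · have hne : cell K i ≠ ∅ := by
        rw [← Finset.nonempty_iff_ne_empty, ← Finset.card_pos, card_cell]
        split_ifs <;> omega
      simp [col, cell, hj]
      intro h
      exact (hne h).elim

/-! ### Column reduction on the graph -/

section Trace

variable {N : ℕ} {R : Type} [CommRing R]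

theorem isPivot_edgeCol [Nontrivial R] {a b : ℕ} (hab : a < b) (hb : b < N) :
    IsPivot (edgeCol R N a b) (some ⟨b, hb⟩) := by
  constructor
  · simp [edgeCol, hab.ne']
  · intro r hr
    by_contra h
    have := Fin.lt_def.1 hr
    simp only at this
    rcases edgeCol_ne_zero h with h | h <;> omega

/-- The first `n` columns of the boundary matrix of the graph have been reduced. -/
structure State (K n : ℕ) (low : Fin N → Option (Fin N)) (B : Matrix (Fin N) (Fin N) R) :
    Prop where
  untouched : ∀ j : Fin N, n ≤ j.val → ∀ r, B r j = col K R N j r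
  path : ∀ i : Fin N, i.val < n → 2 * K < i.val → i.val ≤ 4 * K →
    (∃ l : Fin N, l.val + 2 * K = i.val ∧ low i = some l) ∧ ∀ r, B r i = col K R N i r
  other : ∀ i : Fin N, i.val < n → ¬ (2 * K < i.val ∧ i.val ≤ 4 * K) → low i = none

namespace State

variable {n : ℕ} {low : Fin N → Option (Fin N)} {B : Matrix (Fin N) (Fin N) R}

theorem of_low {i l : Fin N} (h : State K n low B) (hi : i.val < n) (hl : low i = some l) :
    (2 * K < i.val ∧ i.val ≤ 4 * K) ∧ l.val + 2 * K = i.val := by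
  have h1 : 2 * K < i.val ∧ i.val ≤ 4 * K := by
    by_contra h0
    simp [h.other i hi h0] at hl
  obtain ⟨⟨l', h2, h3⟩, -⟩ := h.path i hi h1.1 h1.2
  rw [hl] at h3
  cases h3
  exact ⟨h1, h2⟩

theorem update {j : Fin N} (h : State K j.val low B) {v : Fin N → R} {o : Option (Fin N)}
    (hp : 2 * K < j.val → j.val ≤ 4 * K →
      (∃ l : Fin N, l.val + 2 * K = j.val ∧ o = some l) ∧ ∀ r, v r = col K R N j r)
    (ho : ¬ (2 * K < j.val ∧ j.val ≤ 4 * K) → o = none) :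
    State K (j.val + 1) (Function.update low j o) (B.updateCol j v) := by
  have key : ∀ i : Fin N, i.val < j.val + 1 → i ≠ j → i.val < j.val := by
    intro i hi hij
    have := Fin.val_ne_of_ne hij
    omega
  refine ⟨?_, ?_, ?_⟩
  · intro i hi r
    rw [Matrix.updateCol_ne (by rintro rfl; omega), h.untouched i (by omega)]
  · intro i hi h1 h2
    by_cases hij : i = j
    · subst hij
      simpa using hp h1 h2
    · simpa [Matrix.updateCol_ne hij, hij] using h.path i (key i hi hij) h1 h2
  · intro i hi h1
    by_cases hij : i = j
    · subst hij
      simpa using ho h1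
    · simpa [hij] using h.other i (key i hi hij) h1

variable [Nontrivial R] [Div R] [DecidableEq R]

/-- Reducing an edge that joins vertices at distance `d` on the path takes `d` additions. -/
theorem reduceColumn_edge (h1 : (1 : R) / 1 = 1) {j : Fin N} (h : State K j.val low B)
    (hj : 4 * K < j.val) (d a f : ℕ) (ha : a + d ≤ 2 * K) :
    ∃ c, d * (3 * N) ≤ c ∧ reduceColumn low j (d + f + 1) (B.updateCol j (edgeCol R N a (a + d))) =
      done (B.updateCol j 0, none) c := by
  induction d with
  | zero =>
    have h0 : edgeCol R N a (a + 0) = 0 := by ext r; simp [edgeCol]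
    rw [h0]
    rcases reduceColumn_succ low j (0 + f) (B.updateCol j (0 : Fin N → R)) with
      ⟨c, -, o, ho, -, hr⟩ | ⟨c, -, -, l, i, ho, -⟩
    · have : o = none := ho.unique (o' := none) (fun r => by simp)
      subst this
      exact ⟨c, by simp, hr⟩
    · exact absurd ho.1 (by simp)
  | succ d ih =>
    obtain ⟨c', hc', h'⟩ := ih (by omega)
    have hjN := j.isLt
    have hb : a + (d + 1) < N := by omega
    have hp : IsPivot (fun r => B.updateCol j (edgeCol R N a (a + (d + 1))) r j)
        (some ⟨a + (d + 1), hb⟩) := by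
      simpa using isPivot_edgeCol (R := R) (show a < a + (d + 1) by omega) hb
    rw [show d + 1 + f + 1 = (d + f + 1) + 1 by omega]
    rcases reduceColumn_succ low j (d + f + 1)
        (B.updateCol j (edgeCol R N a (a + (d + 1)))) with
      ⟨c, -, o, ho, hn, -⟩ | ⟨c, -, hc, l, i, ho, hi, hl, hr⟩
    · exfalso
      have := ho.unique hp
      subst this
      -- The path edge with larger vertex `t` sits at position `2 * K + t` and has pivot row `t`, so
      -- it matches the present pivot.
      have hlt : (⟨2 * K + (a + (d + 1)), by omega⟩ : Fin N) < j :=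
        Fin.lt_def.2 (by simp only; omega)
      obtain ⟨⟨l, h2, h3⟩, -⟩ := h.path ⟨2 * K + (a + (d + 1)), by omega⟩ (Fin.lt_def.1 hlt)
        (by simp only; omega) (by simp only; omega)
      refine hn _ rfl _ hlt ?_
      rw [h3]
      congr 1
      ext
      simp only at h2 ⊢
      omega
    · obtain rfl : l = ⟨a + (d + 1), hb⟩ := Option.some_injective _ (ho.unique hp)
      obtain ⟨h2, h3⟩ := h.of_low (Fin.lt_def.1 hi) hl
      have h4 : ∀ r, B r i = edgeCol R N (a + d) (a + (d + 1)) r := by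
        intro r
        rw [(h.path i (Fin.lt_def.1 hi) h2.1 h2.2).2 r]
        simp only at h3
        have h5 : IsEdge K i := ⟨h2.1, by omega⟩
        have h6 : source K i = a + d := by unfold source; rw [if_pos h2.2]; omega
        have h7 : target K i = a + (d + 1) := by unfold target; rw [if_pos h2.2]; omega
        rw [col, if_pos h5, h6, h7]
      refine ⟨c + c', by rw [add_mul]; omega, ?_⟩
      rw [hr]
      simp only [Matrix.updateCol_self, Matrix.updateCol_ne hi.ne, Matrix.updateCol_idem, h4]
      -- Subtracting the last path edge moves the far end of the chord one vertex back.
      have h5 : (fun r => edgeCol R N a (a + (d + 1)) r +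
          -(edgeCol R N a (a + (d + 1)) ⟨a + (d + 1), hb⟩ /
            edgeCol R N (a + d) (a + (d + 1)) ⟨a + (d + 1), hb⟩) *
            edgeCol R N (a + d) (a + (d + 1)) r) = edgeCol R N a (a + d) := by
        have h6 : edgeCol R N a (a + (d + 1)) ⟨a + (d + 1), hb⟩ = 1 := by simp [edgeCol]
        have h7 : edgeCol R N (a + d) (a + (d + 1)) ⟨a + (d + 1), hb⟩ = 1 := by simp [edgeCol]
        ext r
        rw [h6, h7, h1]
        simp only [edgeCol]
        ring
      rw [h5, h', delay_done]

/-- Path edges are already reduced with pivot 1, and chords close cycles and reduce to zero. The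
only division is `1 / 1`, so the argument serves ℤ and fields alike, and the decision algorithm
never stops early. -/
theorem reduceColumn (h1 : (1 : R) / 1 = 1) {j : Fin N} (h : State K j.val low B) :
    ∃ C o c, FieldChoice.reduceColumn low j (N + 1) B = done (C, o) c ∧
      (4 * K < j.val → j.val ≤ 5 * K → 3 * N * K ≤ c) ∧
      State K (j.val + 1) (Function.update low j o) C ∧ ∀ l, o = some l → C l j = 1 := by
  have hself : B.updateCol j (col K R N j) = B := by
    rw [← show (fun r => B r j) = col K R N j from funext fun r => h.untouched j le_rfl r]
    exact Matrix.updateCol_eq_self B j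
  have hcol : (fun r => B r j) = col K R N j := funext fun r => h.untouched j le_rfl r
  have hjN := j.isLt
  by_cases hj : IsEdge K j
  · have hs := source_lt_target hj
    have ht := target_le hj
    have hc : col K R N j = edgeCol R N (source K j) (target K j) := by rw [col, if_pos hj]
    by_cases hj4 : j.val ≤ 4 * K
    · have ht' : target K j + 2 * K = j.val := by
        have := hj.1
        unfold target
        rw [if_pos hj4]
        omega
      have hp : IsPivot (fun r => B r j) (some ⟨target K j, by omega⟩) := by
        rw [hcol, hc]
        exact isPivot_edgeCol hs _
      rcases reduceColumn_succ low j N B with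
        ⟨c, -, o, ho, -, hr⟩ | ⟨c, -, -, l, i, ho, hi, hl, -⟩
      · have := ho.unique hp
        subst this
        refine ⟨B, _, c, hr, by omega, ?_, ?_⟩
        · rw [← hself]
          exact h.update (fun _ _ => ⟨⟨_, ht', rfl⟩, fun _ => rfl⟩)
            (fun h0 => absurd ⟨hj.1, hj4⟩ h0)
        · rintro l ⟨⟩
          rw [h.untouched j le_rfl, hc]
          simp [edgeCol, hs.ne']
      · exfalso
        obtain rfl : l = ⟨target K j, _⟩ := Option.some_injective _ (ho.unique hp)
        have h2 := (h.of_low (Fin.lt_def.1 hi) hl).2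
        have h3 := Fin.lt_def.1 hi
        simp only at h2
        omega
    · have hsj : source K j + 1 ≤ K := by
        have := hj.2
        unfold source
        rw [if_neg hj4]
        omega
      have htj : target K j = 2 * K := by
        unfold target
        rw [if_neg hj4]
      obtain ⟨c, hc1, hc2⟩ := h.reduceColumn_edge h1 (by omega) (2 * K - source K j) (source K j)
        (N - (2 * K - source K j)) (by omega)
      rw [show source K j + (2 * K - source K j) = target K j by omega, ← hc, hself,
        show 2 * K - source K j + (N - (2 * K - source K j)) + 1 = N + 1 by omega] at hc2
      refine ⟨_, none, c, hc2, fun _ _ => le_trans ?_ hc1, ?_, by simp⟩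
      -- A chord starts at a vertex below `K` and ends at `2 * K`, so it takes more than `K`
      -- additions.
      · rw [mul_comm]
        exact Nat.mul_le_mul_right _ (by omega)
      · exact h.update (fun _ h0 => absurd h0 hj4) (fun _ => rfl)
  · have hp : IsPivot (fun r => B r j) none := by
      rw [hcol, col, if_neg hj]
      exact fun _ => rfl
    rcases reduceColumn_succ low j N B with
      ⟨c, -, o, ho, -, hr⟩ | ⟨c, -, -, l, i, ho, -⟩
    · have := ho.unique hp
      subst this
      refine ⟨B, none, c, hr, ?_, ?_, by simp⟩
      · intro h2 h3
        exact absurd ⟨by omega, h3⟩ hj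
      · rw [← hself]
        refine h.update (fun h2 h3 => absurd ⟨h2, by omega⟩ hj) (fun _ => rfl)
    · exact absurd (ho.unique hp) (by simp)

end State

/-- A lower bound for the cost of the columns from `n` on. -/
def lowerCost (K N n : ℕ) : ℕ := (N - n) + 3 * N * K * min K (5 * K + 1 - n)

/-- `min K (5 * K + 1 - n)` is the number of chords at positions from `n` on; it drops by one
exactly when a chord is passed. -/
theorem lowerCost_step {n c : ℕ} (hn : n < N) (h : 4 * K < n → n ≤ 5 * K → 3 * N * K ≤ c) :
    lowerCost K N n ≤ c + (1 + lowerCost K N (n + 1)) := by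
  unfold lowerCost
  by_cases hE : 4 * K < n ∧ n ≤ 5 * K
  · have h1 := h hE.1 hE.2
    have h2 : min K (5 * K + 1 - n) ≤ min K (5 * K + 1 - (n + 1)) + 1 := by omega
    have h3 := Nat.mul_le_mul_left (3 * N * K) h2
    rw [mul_add, mul_one] at h3
    omega
  · have h2 : min K (5 * K + 1 - n) ≤ min K (5 * K + 1 - (n + 1)) := by omega
    have h3 := Nat.mul_le_mul_left (3 * N * K) h2
    omega

theorem lowerCost_self (h : 5 * K + 1 ≤ N) : lowerCost K N N = 0 := by
  unfold lowerCost
  rw [show 5 * K + 1 - N = 0 by omega]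
  simp

theorem State.le_pdLoop {k : Type} [Field k] [DecidableEq k] (hK : 5 * K + 1 ≤ N) (d : ℕ) {n : ℕ}
    (hd : n + d = N) {low : Fin N → Option (Fin N)} {B : Matrix (Fin N) (Fin N) k}
    (h : State K n low B) :
    ∃ x c, pdLoop ((List.finRange N).drop n) low B = done x c ∧ lowerCost K N n ≤ c := by
  induction d generalizing n low B with
  | zero =>
    obtain rfl : n = N := by omega
    rw [show (List.finRange n).drop n = [] from List.drop_eq_nil_of_le (by simp)]
    exact ⟨_, 0, rfl, (lowerCost_self hK).le⟩
  | succ d ih =>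
    have hn : n < N := by omega
    obtain ⟨j, rfl⟩ : ∃ j : Fin N, n = j.val := ⟨⟨n, hn⟩, rfl⟩
    rw [drop_finRange j]
    obtain ⟨C, o, c, h1, h2, h3, -⟩ := h.reduceColumn (by simp)
    obtain ⟨x, c', h4, h5⟩ := ih (by omega) h3
    refine ⟨x, c + (1 + c'), ?_, (lowerCost_step hn h2).trans (by omega)⟩
    simp only [pdLoop, h1, done_bind, tick_bind, h4, delay_done]

theorem State.le_testLoop (M : ℕ) (hK : 5 * K + 1 ≤ N) (d : ℕ) {n : ℕ}
    (hd : n + d = N) {low : Fin N → Option (Fin N)} {B : Matrix (Fin N) (Fin N) ℤ}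
    (h : State K n low B) :
    ∃ x c, testLoop (graph K N).dim M ((List.finRange N).drop n) low B = done x c ∧
      lowerCost K N n ≤ c := by
  induction d generalizing n low B with
  | zero =>
    obtain rfl : n = N := by omega
    rw [show (List.finRange n).drop n = [] from List.drop_eq_nil_of_le (by simp)]
    exact ⟨_, 0, rfl, (lowerCost_self hK).le⟩
  | succ d ih =>
    have hn : n < N := by omega
    obtain ⟨j, rfl⟩ : ∃ j : Fin N, n = j.val := ⟨⟨n, hn⟩, rfl⟩
    rw [drop_finRange j]
    obtain ⟨C, o, c, h1, h2, h3, h6⟩ := h.reduceColumn (by simp)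
    obtain ⟨x, c', h4, h5⟩ := ih (by omega) h3
    have h7 := lowerCost_step hn h2
    cases o with
    | none =>
      refine ⟨x, 1 + (c + (1 + c')), ?_, by omega⟩
      simp only [testLoop, dim_graph_le, decide_true, tick_bind, if_true, h1, done_bind, h4,
        delay_done]
    | some l =>
      refine ⟨x, 1 + (c + (1 + (1 + (1 + c')))), ?_, by omega⟩
      simp only [testLoop, dim_graph_le, decide_true, tick_bind, if_true, h1, done_bind, h4,
        delay_done, h6 l rfl, Bool.true_or]

theorem col_cast {k : Type} [Ring k] (j : ℕ) (r : Fin N) :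
    ((col K ℤ N j r : ℤ) : k) = col K k N j r := by
  unfold col
  split_ifs
  · simp [edgeCol]
  · simp

/-- With N ≤ 5(K + 1) one has N² ≤ 25(K + 1)² ≤ 50(1 + K²), and 60 · 50 = 3000. The summand `N` of
`lowerCost` covers small `N`, where `K = 0`. -/
theorem fifteen_mul_cube_le (hN : 0 < N) :
    4 * (15 * N ^ 3) ≤ 3000 * lowerCost ((N - 1) / 5) N 0 := by
  obtain ⟨K, hK⟩ : ∃ K, K = (N - 1) / 5 := ⟨_, rfl⟩
  rw [← hK]
  have h1 : N ≤ 5 * K + 5 := by omega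
  have h2 : min K (5 * K + 1 - 0) = K := by omega
  unfold lowerCost
  rw [h2, Nat.sub_zero]
  have h3 : N ^ 2 ≤ 50 * (1 + 3 * K * K) := by nlinarith [sq_nonneg ((K : ℤ) - 1)]
  calc 4 * (15 * N ^ 3) = 60 * N * N ^ 2 := by ring
    _ ≤ 60 * N * (50 * (1 + 3 * K * K)) := Nat.mul_le_mul_left _ h3
    _ = 3000 * (N + 3 * N * K * K) := by ring

theorem le_persistence_cost {k : Type} [Field k] [DecidableEq k] (hN : 0 < N) :
    (lowerCost ((N - 1) / 5) N 0 : ℕ∞) ≤ ((graph ((N - 1) / 5) N).persistence k).cost := by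
  have h : State ((N - 1) / 5) 0 (fun _ => none)
      ((graph ((N - 1) / 5) N).incidence.map (Int.cast : ℤ → k)) :=
    ⟨fun j _ r => col_cast j r, by simp, by simp⟩
  obtain ⟨x, c, h1, h2⟩ := h.le_pdLoop (by omega) N (by omega)
  rw [List.drop_zero] at h1
  rw [FilteredComplex.persistence, h1, cost_done]
  exact_mod_cast h2

theorem le_independenceTest_cost (M : ℕ) (hN : 0 < N) :
    (lowerCost ((N - 1) / 5) N 0 : ℕ∞) ≤ ((graph ((N - 1) / 5) N).independenceTest M).cost := by
  have h : State ((N - 1) / 5) 0 (fun _ => none) (graph ((N - 1) / 5) N).incidence :=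
    ⟨fun _ _ _ => rfl, by simp, by simp⟩
  obtain ⟨x, c, h1, h2⟩ := h.le_testLoop M (by omega) N (by omega)
  rw [List.drop_zero] at h1
  rw [FilteredComplex.independenceTest, h1, cost_done]
  exact_mod_cast h2

end Trace

end SlowGraph

/-! ### The theorem -/

namespace FilteredComplex

variable {N : ℕ} (X : FilteredComplex N) (M : ℕ)

theorem independenceTest_correct :
    ∃ v : Verdict, (X.independenceTest M).output = some v ∧
      (v = Verdict.independent ↔ X.AllRelHomologyFree M) ∧
      ∀ p : ℕ, v = Verdict.dependent p →
        2 ≤ p ∧ ∃ m n q r : ℕ, m < n ∧ n ≤ N ∧ q ≤ M ∧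
          Nonempty (X.RelHomology n m q ≃ₗ[ℤ] ZMod p × (Fin r → ℤ)) := by
  obtain ⟨v, c, h1, h2, h3, -⟩ := testLoop_spec (X := X) (M := M) N (zero_add N)
    Reduced.initial (by simp [UnitPivots])
  have hdep : ∀ p : ℕ, v = Verdict.dependent p →
      2 ≤ p ∧ ∃ m n q r : ℕ, m < n ∧ n ≤ N ∧ q ≤ M ∧
        Nonempty (X.RelHomology n m q ≃ₗ[ℤ] ZMod p × (Fin r → ℤ)) := by
    intro p hp
    obtain ⟨j, l, low, B, h, rfl⟩ := h3 p hp
    exact h.exists_equiv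
  refine ⟨v, ?_, ⟨fun hv => ?_, fun hfree => ?_⟩, hdep⟩
  · rw [independenceTest, ← List.drop_zero (l := List.finRange N), h1, output_done]
  · obtain ⟨low, B, hR, hu⟩ := h2 hv
    exact fun q hq m n _ hn => hR.free_relHomology hq hn hu
  · cases v with
    | independent => rfl
    | dependent p =>
      obtain ⟨hp, m, n, q, r, hmn, hn, hq, he⟩ := hdep p rfl
      -- The printed torsion refutes freeness, which gives the converse direction.
      exact absurd (hfree q hq m n hmn hn) (not_free_of_equiv hp he)

theorem independenceTest_cost_le (k : Type) [Field k] [CharZero k] [DecidableEq k] :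
    (X.independenceTest M).cost ≤ 4 * (X.persistence k).cost := by
  obtain ⟨v, c, h1, -, -, h2⟩ := testLoop_spec (X := X) (M := M) N (zero_add N)
    Reduced.initial (by simp [UnitPivots])
  obtain ⟨x, c', h3, h4⟩ := h2 k _ _ Agrees.initial
  rw [List.drop_zero] at h1 h3
  rw [independenceTest, persistence, h1, h3, cost_done, cost_done]
  exact_mod_cast h4

/-- Comparison with the run over ℚ gives a bound that mentions no field, so it can be used against
fields of any characteristic. -/
theorem independenceTest_cost_le_cube :
    (X.independenceTest M).cost ≤ ((4 * (15 * N ^ 3) : ℕ) : ℕ∞) := by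
  refine (X.independenceTest_cost_le M ℚ).trans ?_
  rw [Nat.cast_mul]
  exact mul_le_mul_right X.persistence_cost_le _

end FilteredComplex

/-- If the costs `f` are at most cubic and the costs `g` of the graphs are at least cubic, the
worst case for `f` is at most a constant times the worst case for `g`. -/
theorem iSup_cost_le {N : ℕ} {f g : FilteredComplex N → ℕ∞} {S : Set (FilteredComplex N)}
    (hS : {X | X.IsSimplicial} ⊆ S) (hf : ∀ X, f X ≤ ((4 * (15 * N ^ 3) : ℕ) : ℕ∞))
    (hg : 0 < N → (SlowGraph.lowerCost ((N - 1) / 5) N 0 : ℕ∞) ≤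
      g (SlowGraph.graph ((N - 1) / 5) N)) :
    (⨆ X ∈ S, f X) ≤ (3000 : ℕ) * ⨆ X ∈ S, g X := by
  refine iSup₂_le fun X _ => (hf X).trans ?_
  rcases Nat.eq_zero_or_pos N with rfl | hN
  · simp
  · refine le_trans ?_ (mul_le_mul_right ((hg hN).trans (le_iSup₂ (f := fun X _ => g X)
      (SlowGraph.graph ((N - 1) / 5) N) (hS (SlowGraph.isSimplicial_graph N)))) _)
    exact_mod_cast SlowGraph.fifteen_mul_cube_le hN

end FieldChoice

theorem theorem3 :
    -- correctness, for every filtered complex and every range `0, …, M` of degrees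
    (∀ (N : ℕ) (X : FieldChoice.FilteredComplex N) (M : ℕ),
      ∃ v : FieldChoice.Verdict,
        (X.independenceTest M).output = some v ∧
        (v = FieldChoice.Verdict.independent ↔ X.AllRelHomologyFree M) ∧
        ∀ p : ℕ, v = FieldChoice.Verdict.dependent p →
          2 ≤ p ∧ ∃ m n q r : ℕ, m < n ∧ n ≤ N ∧ q ≤ M ∧
            Nonempty (X.RelHomology n m q ≃ₗ[ℤ] ZMod p × (Fin r → ℤ))) ∧
    -- cost, with one absolute constant
    ∃ C : ℕ,
      -- on every input, against the persistence algorithm over a field of characteristic zero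
      (∀ (N : ℕ) (X : FieldChoice.FilteredComplex N) (M : ℕ)
        (k : Type) [Field k] [CharZero k] [DecidableEq k],
        (X.independenceTest M).cost ≤ C * (X.persistence k).cost) ∧
      -- in the worst case over inputs with `N` cells, against every field, in both directions
      ∀ (N M : ℕ) (k : Type) [Field k] [DecidableEq k]
        (S : Set (FieldChoice.FilteredComplex N)), {X | X.IsSimplicial} ⊆ S →
        (⨆ X ∈ S, (X.persistence k).cost) < ⊤ ∧
        (⨆ X ∈ S, (X.independenceTest M).cost) ≤ C * ⨆ X ∈ S, (X.persistence k).cost ∧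
        (⨆ X ∈ S, (X.persistence k).cost) ≤ C * ⨆ X ∈ S, (X.independenceTest M).cost := by
  refine ⟨fun N X M => X.independenceTest_correct M, 3000, ?_, ?_⟩
  · intro N X M k _ _ _
    refine (X.independenceTest_cost_le M k).trans (mul_le_mul_left ?_ _)
    norm_num
  · intro N M k _ _ S hS
    refine ⟨?_, ?_, ?_⟩
    · exact lt_of_le_of_lt (iSup₂_le fun X _ => X.persistence_cost_le) (ENat.natCast_lt_top _)
    · exact FieldChoice.iSup_cost_le hS (fun X => X.independenceTest_cost_le_cube M)
        FieldChoice.SlowGraph.le_persistence_cost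
    · refine FieldChoice.iSup_cost_le hS (fun X => X.persistence_cost_le.trans ?_)
        (FieldChoice.SlowGraph.le_independenceTest_cost M)
      exact_mod_cast Nat.le_mul_of_pos_left _ (by norm_num)
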